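/- Let $m\ge 1$ be an integer. Let $(M,p)$ be a germ of a real-analytic hypersurface in $\mathbb C^2$. Local holomorphic coordinates $(z,w)$, $w=u+iv$, near $p$ are called \emph{admissible} for $(M,p)$ (with exponent $m$) if in them $p=0$ and $M$ is given by $$v=h(z,\bar z,u)=\tfrac12 u^m\Big(\epsilon |z|^2+\sum_{k,l\ge 2}h_{kl}(u)z^k\bar z^l\Big),\qquad \epsilon=\pm1,$$ with a convergent real-valued series $h$; $(M,p)$ is of (generic) \emph{$m$-infinite type} if such coordinates exist. In these coordinates let $w=\Theta(z,\bar z,\bar w)$ be the complex defining function, i.e. $\frac{\Theta-\tau}{2i}=h\big(z,\chi,\frac{\Theta+\tau}{2}\big)$ for $\Theta=\Theta(z,\chi,\tau)$, $\Theta(0)=0$. There is a unique series $\Phi(z,w,\zeta)=O(\zeta^2)$ such that every function $w(z)=\Theta(z,\chi,\tau)$ solves the associated singular ODE $$w''=w^m\,\Phi\Big(z,w,\frac{w'}{w^m}\Big).$$ Let $\alpha_j,\beta_j,\gamma_j$ denote the coefficients of $z^jw^0\zeta^2$, $z^jw^0\zeta^3$, $z^jw^0\zeta^4$ in $\Phi$.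 The ODE is called \emph{non-resonant} in the following cases. (a) For $m>1$: both the matrix $$\begin{pmatrix}\alpha_0&3\beta_0&\alpha_1&0\\ \alpha_1&3\beta_1&2\alpha_2&\alpha_1\\ 2\beta_0&4\gamma_0&\beta_1&-\beta_0\\ 2\beta_1&2\beta_0\alpha_0+4\gamma_1&2\beta_2&0\end{pmatrix}$$ and its upper right $3\times3$ block are invertible. (b) For $m=1$: the $8\times 8$ matrix $\begin{pmatrix}0&I\\ A&I+B\end{pmatrix}$ has no positive integer eigenvalue, where $$A=\begin{pmatrix}0&3\beta_0&\alpha_1&0\\0&-\beta_1&-\frac23\alpha_2&-\frac13\alpha_1\\0&-4\gamma_0&-\beta_1&\beta_0\\0&-2\beta_0(\alpha_0-1)-4\gamma_1&-2\beta_2&0\end{pmatrix},\qquad B=\begin{pmatrix}\alpha_0-2&0&0&2\\-\frac13\alpha_1&\alpha_0-2&0&0\\-2\beta_0&0&-\alpha_0&0\\-2\beta_1&0&-\alpha_1&-\alpha_0\end{pmatrix}.$$ The germ $(M,p)$ of $m$-infinite type is called \emph{non-resonant} if it has admissible coordinates in which its associated ODE is non-resonant. A \emph{formal biholomorphism} $H:(M,p)\to(M^*,p^*)$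 between germs with defining functions $\rho,\rho^*$ is a formal power series map $H$ centered at $p$ with $H(p)=p^*$ and invertible Jacobian at $p$ such that $\rho^*(H(Z),\overline H(\zeta))$ lies in the ideal generated by $\rho(Z,\zeta)$ in the ring of formal power series in $(Z-p,\zeta-\bar p)$. \textbf{Statement.} Let $(M,p)$ and $(M^*,p^*)$ be non-resonant germs of real-analytic hypersurfaces in $\mathbb C^2$ of $m$-infinite type. Then a formal biholomorphism $H:(M,p)\to(M^*,p^*)$ is uniquely determined by its $m$-jet at $p$: if $H_1,H_2:(M,p)\to(M^*,p^*)$ are formal biholomorphisms with the same $m$-jet at $p$, then $H_1=H_2$. -/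

import Mathlib

open scoped Topology ComplexConjugate

noncomputable section

namespace InfiniteType

/-- A power series in finitely many variables converges near the origin (Cauchy estimates). -/
def Converges {σ : Type} (f : MvPowerSeries σ ℂ) : Prop :=
  ∃ r : ℝ, 0 < r ∧ ∃ C : ℝ, ∀ n : σ →₀ ℕ, ‖MvPowerSeries.coeff n f‖ * r ^ n.degree ≤ C

/-- The value of a power series at a point at which it converges absolutely. -/
def evalSeries {σ : Type} (f : MvPowerSeries σ ℂ) (x : σ → ℂ) : ℂ :=
  ∑' n : σ →₀ ℕ, MvPowerSeries.coeff n f * n.prod fun i k => x i ^ k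

/-- The series whose coefficients are the complex conjugates of those of `f`. -/
def conjSeries {σ : Type} (f : MvPowerSeries σ ℂ) : MvPowerSeries σ ℂ :=
  MvPowerSeries.map (starRingEnd ℂ) f

/-- A germ `(M, p)` of a real-analytic hypersurface in `ℂ²`. Near `p` the set `M = carrier` is
`{p + Z : R(Z, Z̄) = 0}`, where `R(Z, ζ) = defSeries` is a convergent series that is real
(`R̄(ζ, Z) = R(Z, ζ)`, so `R(Z, Z̄)` is real-valued), with `R(0) = 0` and `dR(0) ≠ 0`.
The variables `Z` are indexed by `Sum.inl`, the variables `ζ` (standing for `Z̄`) by `Sum.inr`. -/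
structure RealHypersurfaceGerm where
  carrier : Set (Fin 2 → ℂ)
  point : Fin 2 → ℂ
  defSeries : MvPowerSeries (Fin 2 ⊕ Fin 2) ℂ
  converges : Converges defSeries
  real : MvPowerSeries.rename Sum.swap (conjSeries defSeries) = defSeries
  vanishes : MvPowerSeries.constantCoeff defSeries = 0
  smooth : ∃ i : Fin 2, MvPowerSeries.coeff (Finsupp.single (Sum.inl i) 1) defSeries ≠ 0
  mem_carrier : ∀ᶠ Z in 𝓝 (0 : Fin 2 → ℂ),
    point + Z ∈ carrier ↔ evalSeries defSeries (Sum.elim Z fun i => conj (Z i)) = 0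

/-- A pair of formal power series `H(Z) = (H₀(Z), H₁(Z))`. As a formal map from `(ℂ², p)` to
`(ℂ², p')` it stands for `p + Z ↦ p' + H(Z)`. -/
abbrev FormalMap := Fin 2 → MvPowerSeries (Fin 2) ℂ

/-- `H` has no constant term and its Jacobian determinant at the origin is nonzero. -/
def FormalMap.IsInvertible (H : FormalMap) : Prop :=
  (∀ i, MvPowerSeries.constantCoeff (H i) = 0) ∧
    (Matrix.of fun i j : Fin 2 => MvPowerSeries.coeff (Finsupp.single j 1) (H i)).det ≠ 0

/-- The complexified map `(Z, ζ) ↦ (H(Z), H̄(ζ))`. -/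
def FormalMap.complexify (H : FormalMap) : Fin 2 ⊕ Fin 2 → MvPowerSeries (Fin 2 ⊕ Fin 2) ℂ :=
  Sum.elim (fun i => MvPowerSeries.rename Sum.inl (H i))
    (fun i => MvPowerSeries.rename Sum.inr (conjSeries (H i)))

/-- `H` maps the hypersurface germ `R(Z, Z̄) = 0` into the germ `R'(Z, Z̄) = 0`:
`R'(H(Z), H̄(ζ))` lies in the ideal generated by `R(Z, ζ)`. -/
def FormalMap.MapsInto (H : FormalMap) (R R' : MvPowerSeries (Fin 2 ⊕ Fin 2) ℂ) : Prop :=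
  R ∣ MvPowerSeries.subst H.complexify R'

/-- `H` is a formal biholomorphism `(M, p) → (M', p')`. -/
def IsFormalBiholomorphism (M M' : RealHypersurfaceGerm) (H : FormalMap) : Prop :=
  H.IsInvertible ∧ H.MapsInto M.defSeries M'.defSeries

/-- The exponent of the monomial `x₀ᵃ x₁ᵇ x₂ᶜ`. -/
def expo (a b c : ℕ) : Fin 3 →₀ ℕ :=
  Finsupp.equivFunOnFinite.symm ![a, b, c]

/-- `h(z, z̄, u) = ½ uᵐ (ε z z̄ + ∑_{k,l ≥ 2} h_{kl}(u) zᵏ z̄ˡ)` with `ε = ±1`, convergent and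
real-valued; the variables `z, z̄, u` have indices `0, 1, 2`. -/
def IsAdmissible (m : ℕ) (h : MvPowerSeries (Fin 3) ℂ) : Prop :=
  ∃ (ε : ℂ) (g : MvPowerSeries (Fin 3) ℂ), (ε = 1 ∨ ε = -1) ∧ Converges g ∧
    (∀ k l j, k < 2 ∨ l < 2 → MvPowerSeries.coeff (expo k l j) g = 0) ∧
    (∀ k l j, conj (MvPowerSeries.coeff (expo k l j) g) = MvPowerSeries.coeff (expo l k j) g) ∧
    h = (1 / 2 : ℂ) • (MvPowerSeries.X 2 ^ m *
      (ε • (MvPowerSeries.X 0 * MvPowerSeries.X 1) + g))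

/-- The series of the defining function `v - h(z, z̄, u)`, where `w = u + iv`, that is
`(w - τ)/(2i) - h(z, χ, (w + τ)/2)`; here `(z, w) = Z` and `(χ, τ) = ζ` stands for `(z̄, w̄)`. -/
def graphSeries (h : MvPowerSeries (Fin 3) ℂ) : MvPowerSeries (Fin 2 ⊕ Fin 2) ℂ :=
  (1 / (2 * Complex.I)) •
      (MvPowerSeries.X (Sum.inl 1) - MvPowerSeries.X (Sum.inr 1)) -
    MvPowerSeries.subst
      (![MvPowerSeries.X (Sum.inl 0), MvPowerSeries.X (Sum.inr 0),
        (1 / 2 : ℂ) • (MvPowerSeries.X (Sum.inl 1) + MvPowerSeries.X (Sum.inr 1))] :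
        Fin 3 → MvPowerSeries (Fin 2 ⊕ Fin 2) ℂ) h

/-- `w = Θ(z, χ, τ)` is the complex defining function of `v = h(z, z̄, u)`: the solution of
`(w - τ)/(2i) = h(z, χ, (w + τ)/2)` with `Θ(0) = 0`. The Segre varieties are the graphs
`w = Θ(z, χ, τ)` with parameters `χ, τ`. The variables `z, χ, τ` have indices `0, 1, 2`. -/
def IsComplexDefiningFunction (h Θ : MvPowerSeries (Fin 3) ℂ) : Prop :=
  MvPowerSeries.constantCoeff Θ = 0 ∧
    (1 / (2 * Complex.I)) • (Θ - MvPowerSeries.X 2) =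
      MvPowerSeries.subst
        (![MvPowerSeries.X 0, MvPowerSeries.X 1,
          (1 / 2 : ℂ) • (Θ + MvPowerSeries.X 2)] : Fin 3 → MvPowerSeries (Fin 3) ℂ) h

/-- The singular ODE `w'' = wᵐ Φ(z, w, w'/wᵐ)`, `Φ(z, w, ζ) = O(ζ²)`, is associated with
`v = h(z, z̄, u)`: every `w(z) = Θ(z, χ, τ)` is a solution. The series `S` is the quotient
`Θ_z / Θᵐ`. The variables `z, w, ζ` of `Φ` have indices `0, 1, 2`. For admissible `h` there is
exactly one such series `Φ`. -/
def IsAssociatedODE (m : ℕ) (h Φ : MvPowerSeries (Fin 3) ℂ) : Prop :=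
  (∀ n : Fin 3 →₀ ℕ, n 2 < 2 → MvPowerSeries.coeff n Φ = 0) ∧
    ∃ Θ S : MvPowerSeries (Fin 3) ℂ, IsComplexDefiningFunction h Θ ∧
      MvPowerSeries.constantCoeff S = 0 ∧
      MvPowerSeries.pderiv ℂ 0 Θ = Θ ^ m * S ∧
      MvPowerSeries.pderiv ℂ 0 (MvPowerSeries.pderiv ℂ 0 Θ) =
        Θ ^ m * MvPowerSeries.subst (![MvPowerSeries.X 0, Θ, S] :
          Fin 3 → MvPowerSeries (Fin 3) ℂ) Φ

/-- `αⱼ`, the coefficient of `zʲ w⁰ ζ²` in `Φ`. -/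
def alpha (Φ : MvPowerSeries (Fin 3) ℂ) (j : ℕ) : ℂ := MvPowerSeries.coeff (expo j 0 2) Φ

/-- `βⱼ`, the coefficient of `zʲ w⁰ ζ³` in `Φ`. -/
def beta (Φ : MvPowerSeries (Fin 3) ℂ) (j : ℕ) : ℂ := MvPowerSeries.coeff (expo j 0 3) Φ

/-- `γⱼ`, the coefficient of `zʲ w⁰ ζ⁴` in `Φ`. -/
def gamma (Φ : MvPowerSeries (Fin 3) ℂ) (j : ℕ) : ℂ := MvPowerSeries.coeff (expo j 0 4) Φ

/-- For `m = 1`, write a map as `(z + f₀(w) + f₁(w) z + ⋯, w + w g₀(w) + w g₁(w) z + ⋯)`. The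
normalizing system for the Cauchy data `H = (g₀, g₁, f₀, f₁)` is `w² H'' = T(w, H, wH')`; this is
`∂T/∂H` at the origin. -/
def cauchyMatrixH (Φ : MvPowerSeries (Fin 3) ℂ) : Matrix (Fin 4) (Fin 4) ℂ :=
  !![0, 3 * beta Φ 0, alpha Φ 1, 0;
     0, -beta Φ 1, -(2 / 3) * alpha Φ 2, -(1 / 3) * alpha Φ 1;
     0, -4 * gamma Φ 0, -beta Φ 1, beta Φ 0;
     0, -(2 * beta Φ 0 * (alpha Φ 0 - 1) + 4 * gamma Φ 1), -2 * beta Φ 2, 0]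

/-- `∂T/∂(wH')` at the origin, in the notation of `cauchyMatrixH`. -/
def cauchyMatrixG (Φ : MvPowerSeries (Fin 3) ℂ) : Matrix (Fin 4) (Fin 4) ℂ :=
  !![alpha Φ 0 - 2, 0, 0, 2;
     -(1 / 3) * alpha Φ 1, alpha Φ 0 - 2, 0, 0;
     -2 * beta Φ 0, 0, -alpha Φ 0, 0;
     -2 * beta Φ 1, 0, -alpha Φ 1, -alpha Φ 0]

/-- The linearization matrix at the origin of the first order system
`w H' = G`, `w G' = G + T(w, H, G)` for the Cauchy data. -/
def cauchyMatrix (Φ : MvPowerSeries (Fin 3) ℂ) : Matrix (Fin 4 ⊕ Fin 4) (Fin 4 ⊕ Fin 4) ℂ :=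
  Matrix.fromBlocks 0 1 (cauchyMatrixH Φ) (1 + cauchyMatrixG Φ)

/-- The `4 × 4` matrix of the nonresonance condition for `m > 1`. -/
def resonanceMatrix (Φ : MvPowerSeries (Fin 3) ℂ) : Matrix (Fin 4) (Fin 4) ℂ :=
  !![alpha Φ 0, 3 * beta Φ 0, alpha Φ 1, 0;
     alpha Φ 1, 3 * beta Φ 1, 2 * alpha Φ 2, alpha Φ 1;
     2 * beta Φ 0, 4 * gamma Φ 0, beta Φ 1, -beta Φ 0;
     2 * beta Φ 1, 2 * beta Φ 0 * alpha Φ 0 + 4 * gamma Φ 1, 2 * beta Φ 2, 0]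

/-- The upper right `3 × 3` block of `resonanceMatrix`. -/
def resonanceMinor (Φ : MvPowerSeries (Fin 3) ℂ) : Matrix (Fin 3) (Fin 3) ℂ :=
  (resonanceMatrix Φ).submatrix Fin.castSucc Fin.succ

/-- Nonresonance of the ODE `w'' = wᵐ Φ(z, w, w'/wᵐ)`. For `m = 1`: the linearization matrix of
the system for the Cauchy data has no positive integer eigenvalue. For `m > 1`: the resonance
matrix and its upper right `3 × 3` block are invertible. -/
def IsNonResonantODE (m : ℕ) (Φ : MvPowerSeries (Fin 3) ℂ) : Prop :=
  (m = 1 → ∀ k : ℕ, 0 < k →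
    ¬ Module.End.HasEigenvalue (Matrix.toLin' (cauchyMatrix Φ)) (k : ℂ)) ∧
  (1 < m → IsUnit (resonanceMatrix Φ) ∧ IsUnit (resonanceMinor Φ))

/-- `(z, w) = φ(Z)` are holomorphic admissible coordinates for `(M, p)`, in which `p` is the
origin and `M` is `v = h(z, z̄, u)` with `h = ½ uᵐ (± |z|² + ∑_{k,l ≥ 2} h_{kl}(u) zᵏ z̄ˡ)`. -/
def IsAdmissibleCoordinates (m : ℕ) (M : RealHypersurfaceGerm) (φ : FormalMap)
    (h : MvPowerSeries (Fin 3) ℂ) : Prop :=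
  (∀ i, Converges (φ i)) ∧ φ.IsInvertible ∧ IsAdmissible m h ∧
    φ.MapsInto M.defSeries (graphSeries h)

/-- `(M, p)` is of (generic) `m`-infinite type and non-resonant: it has admissible coordinates
with exponent `m` in which its associated ODE is nonresonant. (Such an `M` is Levi-nonflat and
contains the complex curve `w = 0`.) -/
def RealHypersurfaceGerm.IsNonResonantOfInfiniteType (M : RealHypersurfaceGerm) (m : ℕ) : Prop :=
  ∃ (φ : FormalMap) (h Φ : MvPowerSeries (Fin 3) ℂ), IsAdmissibleCoordinates m M φ h ∧
    IsAssociatedODE m h Φ ∧ IsNonResonantODE m Φ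

end InfiniteType

end

open scoped Topology ComplexConjugate

noncomputable section

namespace InfiniteType

open MvPowerSeries

/-! ### Calculus of formal power series: congruences, substitution, chain rule, Taylor expansion. -/

section Tools

variable {σ τ υ : Type*}

/-! Applied to `H₂⁻¹ ∘ H₁`, the theorem reduces to this: a formal self-map of `M` with the `m`-jet
of the identity is the identity. Conjugating by admissible coordinates keeps the jet condition, so
`M` may be taken in the form v = h(z, z̄, u). Write m = p + 1.

A self-map (F, G) permutes the Segre varieties w = Θ(z, χ, τ), so it is a symmetry of the associated
ODE. The map (z, χ, τ) ↦ (z, Θ, Θ_z/Θᵐ) is formally invertible (`exists_jet_inverse`). Hence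
identities along the Segre varieties become identities in independent variables (z, w, ζ), with ∂/∂z
replaced by the total derivative D (`pderiv_subst_jet`). The symmetry conditions read DG = Gᵐ σ DF
and D(Gᵐ σ) = Gᵐ Φ(F, G, σ) DF, where σ is the third component of the prolonged map.

That such a symmetry is trivial is proved by induction on its order of contact with the identity
along w = 0 (`eq_X_of_symmetry`). Write F = z + wᵏ f and G = w + wᵏ⁺¹ a(w) + wᵏ⁺ᵐ b(z, w) with b(0,
w) = 0 and k = q + 1. Modulo w, the coefficients of ζ⁰, …, ζ³ in the second condition give four
linear equations for a(0), b(z, 0), f(z, 0) (`determiningTerms_eq_zero`). The first two express b''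
and f'' through b', so only the Cauchy data b'(0), f(0), f'(0) and the number a(0) remain free. The
other two, with their first z-derivatives, evaluated at the origin, are four linear equations for
these four numbers. For m = 1 a nonzero solution yields an eigenvector of `cauchyMatrix` with
eigenvalue k. For m > 1 the vector with first entry (k + 1 - m) a(0) lies in the kernel of
`resonanceMatrix`. Nonresonance excludes both (`cauchyData_eq_zero`). Only for k = m - 1 does a(0)
escape; it is then the coefficient of wᵐ in G, and the `m`-jet supplies it.

The induction starts because the jet condition at the origin propagates along w = 0: comparing Segre
varieties gives G ≡ w modulo wᵐ⁺¹ (`X_pow_dvd_second_sub`) and F ≡ z modulo w (`X_dvd_first_sub`).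
-/

/-- The series all of whose coefficients with exponents in the lower set `E` vanish. -/
def vanishingIdeal (E : LowerSet (τ →₀ ℕ)) : Ideal (MvPowerSeries τ ℂ) where
  carrier := {f | ∀ e ∈ E, coeff e f = 0}
  zero_mem' := by simp
  add_mem' := by
    intro f g hf hg e he
    rw [map_add, hf e he, hg e he, add_zero]
  smul_mem' := by
    classical
    intro f g hg e he
    rw [smul_eq_mul, coeff_mul]
    refine Finset.sum_eq_zero fun p hp => ?_
    rw [hg p.2 (E.lower (by
      rw [← Finset.HasAntidiagonal.mem_antidiagonal.1 hp]; exact le_add_self) he), mul_zero]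

/-- The exponents whose `j`-th entry is less than `n`. -/
def belowEntry (j : τ) (n : ℕ) : LowerSet (τ →₀ ℕ) where
  carrier := {e | e j < n}
  lower' := fun _ _ h he => lt_of_le_of_lt (h j) he

/-- The exponents of degree less than `n`. -/
def belowDegree (τ : Type*) (n : ℕ) : LowerSet (τ →₀ ℕ) where
  carrier := {e | e.degree < n}
  lower' := fun _ _ h he => lt_of_le_of_lt (Finsupp.degree_mono h) he

theorem mem_vanishingIdeal_belowEntry {j : τ} {n : ℕ} {f : MvPowerSeries τ ℂ} :
    f ∈ vanishingIdeal (belowEntry j n) ↔ X j ^ n ∣ f :=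
  X_pow_dvd_iff.symm

theorem mem_belowDegree {n : ℕ} {f : MvPowerSeries τ ℂ} :
    f ∈ vanishingIdeal (belowDegree τ n) ↔ ∀ e : τ →₀ ℕ, e.degree < n → coeff e f = 0 := Iff.rfl

theorem mem_belowDegree_one {f : MvPowerSeries τ ℂ} :
    f ∈ vanishingIdeal (belowDegree τ 1) ↔ constantCoeff f = 0 := by
  rw [mem_belowDegree]
  constructor
  · intro h
    simpa using h 0 (by simp)
  · intro h e he
    have : e = 0 := by simpa [Finsupp.degree_eq_zero_iff] using he
    rw [this, coeff_zero_eq_constantCoeff_apply, h]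

theorem mul_mem_belowDegree {p q : ℕ} {f g : MvPowerSeries τ ℂ}
    (hf : f ∈ vanishingIdeal (belowDegree τ p)) (hg : g ∈ vanishingIdeal (belowDegree τ q)) :
    f * g ∈ vanishingIdeal (belowDegree τ (p + q)) := by
  intro e he
  have he' : e.degree < p + q := he
  refine coeff_of_lt_order (lt_of_lt_of_le ?_ le_order_mul)
  refine lt_of_lt_of_le (by exact_mod_cast he') (add_le_add (nat_le_order hf) (nat_le_order hg))

theorem eq_zero_of_forall_mem_belowDegree {f : MvPowerSeries τ ℂ}
    (h : ∀ n, f ∈ vanishingIdeal (belowDegree τ n)) : f = 0 := by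
  ext e
  exact h (e.degree + 1) e (Nat.lt_succ_self _)

section Euler

/-- The coefficients of `f = f(0) + ∑ Xᵢ fᵢ`, made canonical with Euler's identity. -/
def eulerPart (f : MvPowerSeries σ ℂ) (i : σ) : MvPowerSeries σ ℂ :=
  fun d => coeff d (pderiv ℂ i f) / (d.degree + 1)

theorem coeff_eulerPart (f : MvPowerSeries σ ℂ) (i : σ) (d : σ →₀ ℕ) :
    coeff d (eulerPart f i) = coeff (d + Finsupp.single i 1) f * (d i + 1) / (d.degree + 1) := by
  rw [← coeff_pderiv]; rfl

theorem coeff_X_mul' [DecidableEq σ] (f : MvPowerSeries σ ℂ) (i : σ) (d : σ →₀ ℕ) :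
    coeff d (X i * f) = if d i = 0 then 0 else coeff (d - Finsupp.single i 1) f := by
  rw [X_def, coeff_monomial_mul]
  by_cases h : d i = 0
  · simp [h, Finsupp.single_le_iff]
  · have : 1 ≤ d i := Nat.one_le_iff_ne_zero.2 h
    simp [h, Finsupp.single_le_iff, this]

theorem eq_add_sum_X_mul_eulerPart [Fintype σ] (f : MvPowerSeries σ ℂ) :
    f = C (constantCoeff f) + ∑ i, X i * eulerPart f i := by
  classical
  ext d
  rw [map_add, map_sum]
  by_cases hd : d = 0
  · subst hd
    simp [coeff_X_mul']
  · rw [coeff_C, if_neg hd, zero_add]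
    -- The i-th summand carries the share d i / |d| of the coefficient, and these shares add up to
    -- 1.
    have key : ∀ i, coeff d (X i * eulerPart f i) = coeff d f / d.degree * d i := by
      intro i
      rw [coeff_X_mul']
      split_ifs with h
      · simp [h]
      · have h1 : Finsupp.single i 1 ≤ d := by
          rw [Finsupp.single_le_iff]; exact Nat.one_le_iff_ne_zero.2 h
        obtain ⟨d', rfl⟩ : ∃ d', d = d' + Finsupp.single i 1 :=
          ⟨d - Finsupp.single i 1, (tsub_add_cancel_of_le h1).symm⟩
        rw [add_tsub_cancel_right, coeff_eulerPart]
        simp only [map_add, Finsupp.degree_single, Finsupp.add_apply, Finsupp.single_eq_same]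
        push_cast
        ring
    rw [Finset.sum_congr rfl fun i _ => key i, ← Finset.mul_sum]
    have hs : (∑ i, (d i : ℂ)) = d.degree := by
      rw [Finsupp.degree_eq_sum]; push_cast; rfl
    rw [hs, div_mul_cancel₀]
    simpa [Finsupp.degree_eq_zero_iff] using hd

theorem eulerPart_mem_belowDegree {f : MvPowerSeries σ ℂ} {n : ℕ}
    (hf : f ∈ vanishingIdeal (belowDegree σ (n + 1))) (i : σ) :
    eulerPart f i ∈ vanishingIdeal (belowDegree σ n) := by
  intro e he
  have he' : e.degree < n := he
  rw [coeff_eulerPart, hf, zero_mul, zero_div]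
  change (e + Finsupp.single i 1).degree < n + 1
  simpa using he'

end Euler

variable [Fintype σ]

/-- A property of series that reduces from `f` to the parts of `f` in Euler's decomposition holds
for every series. -/
theorem mem_vanishingIdeal_of_contraction (E : LowerSet (τ →₀ ℕ)) {a : σ → MvPowerSeries τ ℂ}
    (ha : ∀ i, constantCoeff (a i) = 0) (Q : MvPowerSeries σ ℂ → MvPowerSeries τ ℂ)
    (hQ : ∀ f, Q f - ∑ i, a i * Q (eulerPart f i) ∈ vanishingIdeal E) (f : MvPowerSeries σ ℂ) :
    Q f ∈ vanishingIdeal E := by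
  classical
  have main : ∀ n, ∀ e ∈ E, e.degree < n → ∀ f, coeff e (Q f) = 0 := by
    intro n
    induction n with
    | zero => intro e _ h; exact absurd h (Nat.not_lt_zero _)
    | succ n ih =>
      intro e he hn f
      have h := hQ f e he
      rw [map_sub, sub_eq_zero] at h
      rw [h, map_sum]
      refine Finset.sum_eq_zero fun i _ => ?_
      rw [coeff_mul]
      refine Finset.sum_eq_zero fun p hp => ?_
      have hp' := Finset.HasAntidiagonal.mem_antidiagonal.1 hp
      -- Since `a i` has no constant term, only coefficients of `Q (eulerPart f i)` of degree below
      -- that of `e` contribute, and the induction hypothesis covers these for every series.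
      by_cases h0 : p.1 = 0
      · rw [h0, coeff_zero_eq_constantCoeff_apply, ha, zero_mul]
      · have hdeg : p.1.degree + p.2.degree = e.degree := by rw [← hp', map_add]
        have : p.1.degree ≠ 0 := by simpa [Finsupp.degree_eq_zero_iff] using h0
        rw [ih p.2 (E.lower (by rw [← hp']; exact le_add_self) he) (by omega), mul_zero]
  exact fun e he => main (e.degree + 1) e he (Nat.lt_succ_self _) f

theorem hasSubst_of_zero {a : σ → MvPowerSeries τ ℂ}
    (ha : ∀ i, constantCoeff (a i) = 0) : HasSubst a :=
  hasSubst_of_constantCoeff_zero ha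

theorem subst_eulerPart {a : σ → MvPowerSeries τ ℂ}
    (ha : ∀ i, constantCoeff (a i) = 0) (f : MvPowerSeries σ ℂ) :
    subst a f = C (constantCoeff f) + ∑ i, a i * subst a (eulerPart f i) := by
  have h := hasSubst_of_zero ha
  conv_lhs => rw [eq_add_sum_X_mul_eulerPart f]
  rw [← coe_substAlgHom h]
  simp only [map_add, map_sum, map_mul, coe_substAlgHom, subst_C, subst_X h]

theorem constantCoeff_subst_of_zero {a : σ → MvPowerSeries τ ℂ}
    (ha : ∀ i, constantCoeff (a i) = 0) (f : MvPowerSeries σ ℂ) :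
    constantCoeff (subst a f) = constantCoeff f := by
  rw [subst_eulerPart ha]
  simp [ha]

/-- Substitution respects congruences. -/
theorem subst_sub_subst_mem (E : LowerSet (τ →₀ ℕ)) {a b : σ → MvPowerSeries τ ℂ}
    (ha : ∀ i, constantCoeff (a i) = 0) (hb : ∀ i, constantCoeff (b i) = 0)
    (hab : ∀ i, a i - b i ∈ vanishingIdeal E) (f : MvPowerSeries σ ℂ) :
    subst a f - subst b f ∈ vanishingIdeal E := by
  refine mem_vanishingIdeal_of_contraction E ha (fun f => subst a f - subst b f) (fun f => ?_) f
  have : subst a f - subst b f - ∑ i, a i * (subst a (eulerPart f i) - subst b (eulerPart f i))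
      = ∑ i, subst b (eulerPart f i) * (a i - b i) := by
    rw [subst_eulerPart ha f, subst_eulerPart hb f, add_sub_add_left_eq_sub,
      ← Finset.sum_sub_distrib, ← Finset.sum_sub_distrib]
    exact Finset.sum_congr rfl fun i _ => by ring
  rw [this]
  exact Ideal.sum_mem _ fun i _ => Ideal.mul_mem_left _ _ (hab i)

theorem X_pow_dvd_subst_sub_subst {j : τ} {n : ℕ} {a b : σ → MvPowerSeries τ ℂ}
    (ha : ∀ i, constantCoeff (a i) = 0) (hb : ∀ i, constantCoeff (b i) = 0)
    (hab : ∀ i, X j ^ n ∣ a i - b i) (f : MvPowerSeries σ ℂ) :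
    X j ^ n ∣ subst a f - subst b f := by
  rw [← mem_vanishingIdeal_belowEntry]
  exact subst_sub_subst_mem _ ha hb (fun i => mem_vanishingIdeal_belowEntry.2 (hab i)) f

omit [Fintype σ] in
theorem pderiv_eq_of_eq_add_sum (s : Finset σ) [DecidableEq σ] (f : MvPowerSeries σ ℂ) (c : ℂ)
    (g : σ → MvPowerSeries σ ℂ) (hf : f = C c + ∑ i ∈ s, X i * g i) (i : σ) (hi : i ∈ s) :
    pderiv ℂ i f = g i + ∑ k ∈ s, X k * pderiv ℂ i (g k) := by
  rw [hf]
  simp only [map_add, map_sum, Derivation.leibniz, pderiv_C, zero_add, smul_eq_mul, pderiv_X]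
  rw [Finset.sum_add_distrib, add_comm]
  congr 1
  rw [Finset.sum_eq_single i]
  · simp
  · intro b _ hb; simp [hb]
  · exact fun h => absurd hi h

/-- The chain rule. -/
theorem pderiv_subst {a : σ → MvPowerSeries τ ℂ} (ha : ∀ i, constantCoeff (a i) = 0)
    (j : τ) (f : MvPowerSeries σ ℂ) :
    pderiv ℂ j (subst a f) = ∑ i, subst a (pderiv ℂ i f) * pderiv ℂ j (a i) := by
  classical
  rw [← sub_eq_zero]
  refine eq_zero_of_forall_mem_belowDegree fun n => ?_
  -- The defect of the chain rule satisfies Q f = ∑ aᵢ Q fᵢ exactly, by the Leibniz rule on Euler's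
  -- decomposition, so it vanishes to every order.
  refine mem_vanishingIdeal_of_contraction _ ha
    (fun f => pderiv ℂ j (subst a f) - ∑ i, subst a (pderiv ℂ i f) * pderiv ℂ j (a i))
    (fun f => ?_) f
  have hs := hasSubst_of_zero ha
  convert Ideal.zero_mem _ using 1
  rw [sub_eq_zero]
  have h1 : pderiv ℂ j (subst a f) = ∑ i, (a i * pderiv ℂ j (subst a (eulerPart f i)) +
      subst a (eulerPart f i) * pderiv ℂ j (a i)) := by
    rw [subst_eulerPart ha f]
    simp [Derivation.leibniz]
  have h2 : ∀ i, subst a (pderiv ℂ i f) = subst a (eulerPart f i) +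
      ∑ k, a k * subst a (pderiv ℂ i (eulerPart f k)) := by
    intro i
    rw [pderiv_eq_of_eq_add_sum Finset.univ f _ _ (eq_add_sum_X_mul_eulerPart f) i
      (Finset.mem_univ _), ← coe_substAlgHom hs]
    simp only [map_add, map_sum, map_mul, coe_substAlgHom, subst_X hs]
  rw [h1]
  simp only [h2, add_mul, Finset.sum_add_distrib, mul_sub, Finset.sum_sub_distrib, Finset.mul_sum,
    Finset.sum_mul]
  rw [add_sub_assoc, sub_add_cancel_left, ← sub_eq_add_neg]
  congr 1
  rw [Finset.sum_comm]
  exact Finset.sum_congr rfl fun i _ => Finset.sum_congr rfl fun k _ => by ring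

/-- The first order Taylor expansion. -/
theorem X_pow_dvd_taylor {j : τ} {n : ℕ} {a b : σ → MvPowerSeries τ ℂ} (hn : n ≠ 0)
    (ha : ∀ i, constantCoeff (a i) = 0) (f : MvPowerSeries σ ℂ) :
    X j ^ (2 * n) ∣ subst (fun i => a i + X j ^ n * b i) f - subst a f -
      X j ^ n * ∑ i, subst a (pderiv ℂ i f) * b i := by
  classical
  have hs := hasSubst_of_zero ha
  have hab : ∀ i, constantCoeff (a i + X j ^ n * b i) = 0 := by
    intro i; simp [ha, hn]
  rw [← mem_vanishingIdeal_belowEntry]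
  refine mem_vanishingIdeal_of_contraction _ ha
    (fun f => subst (fun i => a i + X j ^ n * b i) f - subst a f -
      X j ^ n * ∑ i, subst a (pderiv ℂ i f) * b i) (fun f => ?_) f
  have h2 : ∀ i, subst a (pderiv ℂ i f) = subst a (eulerPart f i) +
      ∑ k, a k * subst a (pderiv ℂ i (eulerPart f k)) := by
    intro i
    rw [pderiv_eq_of_eq_add_sum Finset.univ f _ _ (eq_add_sum_X_mul_eulerPart f) i
      (Finset.mem_univ _), ← coe_substAlgHom hs]
    simp only [map_add, map_sum, map_mul, coe_substAlgHom, subst_X hs]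
  -- With t = X_jⁿ, the Taylor remainder obeys the contraction recursion up to t bᵢ (fᵢ(a + t b) -
  -- fᵢ(a)), and the bracket supplies the second factor t.
  have key : subst (fun i => a i + X j ^ n * b i) f - subst a f -
      X j ^ n * ∑ i, subst a (pderiv ℂ i f) * b i - ∑ i, a i *
        (subst (fun i => a i + X j ^ n * b i) (eulerPart f i) - subst a (eulerPart f i) -
        X j ^ n * ∑ k, subst a (pderiv ℂ k (eulerPart f i)) * b k) =
      ∑ i, X j ^ n * b i *
        (subst (fun i => a i + X j ^ n * b i) (eulerPart f i) - subst a (eulerPart f i)) := by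
    rw [subst_eulerPart hab f, subst_eulerPart ha f]
    simp only [h2, add_mul, Finset.sum_add_distrib, mul_sub, Finset.sum_sub_distrib,
      Finset.mul_sum, Finset.sum_mul, mul_add]
    have h3 : ∑ x, ∑ i, X j ^ n * (a i * subst a (pderiv ℂ x (eulerPart f i)) * b x) =
        ∑ x, ∑ i, a x * (X j ^ n * (subst a (pderiv ℂ i (eulerPart f x)) * b i)) := by
      rw [Finset.sum_comm]
      exact Finset.sum_congr rfl fun i _ => Finset.sum_congr rfl fun k _ => by ring
    have h4 : ∑ x, X j ^ n * (subst a (eulerPart f x) * b x) =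
        ∑ x, X j ^ n * b x * subst a (eulerPart f x) :=
      Finset.sum_congr rfl fun i _ => by ring
    rw [h3, h4]
    ring
  rw [key]
  refine Ideal.sum_mem _ fun i _ => ?_
  rw [mem_vanishingIdeal_belowEntry, two_mul, pow_add]
  refine mul_dvd_mul (dvd_mul_right _ _) ?_
  exact X_pow_dvd_subst_sub_subst hab ha (fun i => by simp) _

end Tools

/-! ### The formal inverse function theorem. -/

section Inverse

variable {σ τ υ : Type*} [Fintype σ]

theorem coeff_single_eq (f : MvPowerSeries τ ℂ) (j : τ) :
    coeff (Finsupp.single j 1) f = constantCoeff (pderiv ℂ j f) := by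
  rw [← coeff_zero_eq_constantCoeff_apply, coeff_pderiv]
  simp

theorem coeff_single_subst {a : σ → MvPowerSeries τ ℂ} (ha : ∀ i, constantCoeff (a i) = 0)
    (f : MvPowerSeries σ ℂ) (j : τ) :
    coeff (Finsupp.single j 1) (subst a f) =
      ∑ i, coeff (Finsupp.single i 1) f * coeff (Finsupp.single j 1) (a i) := by
  rw [coeff_single_eq, pderiv_subst ha, map_sum]
  refine Finset.sum_congr rfl fun i _ => ?_
  rw [map_mul, constantCoeff_subst_of_zero ha, coeff_single_eq, coeff_single_eq]

theorem subst_subst [Fintype τ] {a : σ → MvPowerSeries τ ℂ} {b : τ → MvPowerSeries υ ℂ}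
    (ha : ∀ i, constantCoeff (a i) = 0) (hb : ∀ i, constantCoeff (b i) = 0)
    (f : MvPowerSeries σ ℂ) :
    subst b (subst a f) = subst (fun i => subst b (a i)) f :=
  subst_comp_subst_apply (hasSubst_of_zero ha) (hasSubst_of_zero hb) f

omit [Fintype σ] in
theorem subst_X_eq (f : MvPowerSeries σ ℂ) :
    subst (fun i => (X i : MvPowerSeries σ ℂ)) f = f := congrFun subst_self f

/-- Substituting a map tangent to the identity does not change the leading terms. -/
theorem sub_subst_mem_belowDegree {a : σ → MvPowerSeries σ ℂ}
    (ha : ∀ i, constantCoeff (a i) = 0)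
    (h2 : ∀ i, X i - a i ∈ vanishingIdeal (belowDegree σ 2)) (n : ℕ) (f : MvPowerSeries σ ℂ)
    (hf : f ∈ vanishingIdeal (belowDegree σ n)) :
    f - subst a f ∈ vanishingIdeal (belowDegree σ (n + 1)) := by
  induction n generalizing f with
  | zero =>
    rw [mem_belowDegree_one, map_sub, constantCoeff_subst_of_zero ha, sub_self]
  | succ n ih =>
    have e : f - subst a f = ∑ i, (X i * (eulerPart f i - subst a (eulerPart f i)) +
        (X i - a i) * subst a (eulerPart f i)) := by
      rw [subst_eulerPart ha f]
      nth_rewrite 1 [eq_add_sum_X_mul_eulerPart f]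
      rw [add_sub_add_left_eq_sub, ← Finset.sum_sub_distrib]
      exact Finset.sum_congr rfl fun i _ => by ring
    rw [e]
    refine Ideal.sum_mem _ fun i _ => Ideal.add_mem _ ?_ ?_
    · have h := mul_mem_belowDegree (mem_belowDegree_one.2 (constantCoeff_X (R := ℂ) i))
        (ih _ (eulerPart_mem_belowDegree hf i))
      rwa [add_comm] at h
    · have h1 := ih _ (eulerPart_mem_belowDegree hf i)
      have h3 : subst a (eulerPart f i) ∈ vanishingIdeal (belowDegree σ n) := by
        have h4 : eulerPart f i - subst a (eulerPart f i) ∈ vanishingIdeal (belowDegree σ n) :=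
          fun e he => h1 e (lt_trans (show e.degree < n from he) (Nat.lt_succ_self _))
        have := Ideal.sub_mem _ (eulerPart_mem_belowDegree hf i) h4
        rwa [sub_sub_cancel] at this
      have h := mul_mem_belowDegree (h2 i) h3
      rwa [add_comm] at h

theorem subst_mem_belowDegree {a : σ → MvPowerSeries τ ℂ}
    (ha : ∀ i, constantCoeff (a i) = 0) (n : ℕ) (f : MvPowerSeries σ ℂ)
    (hf : f ∈ vanishingIdeal (belowDegree σ n)) :
    subst a f ∈ vanishingIdeal (belowDegree τ n) := by
  induction n generalizing f with
  | zero => exact fun e he => absurd (show e.degree < 0 from he) (Nat.not_lt_zero _)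
  | succ n ih =>
    have h0 : constantCoeff f = 0 := by
      simpa using hf 0 (by change Finsupp.degree 0 < n + 1; simp)
    rw [subst_eulerPart ha f, h0, map_zero, zero_add]
    refine Ideal.sum_mem _ fun i _ => ?_
    rw [add_comm n 1]
    exact mul_mem_belowDegree (mem_belowDegree_one.2 (ha i))
      (ih _ (eulerPart_mem_belowDegree hf i))

/-- Neumann series: L g = g - g ∘ a raises the order of vanishing, so ∑ Lᵏ f makes sense and solves
b ∘ a = f. A coefficient of degree n is already final in the partial sum over k ≤ n, which is how
`b` is defined. -/
theorem exists_left_inverse_of_tangent {a : σ → MvPowerSeries σ ℂ}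
    (ha : ∀ i, constantCoeff (a i) = 0)
    (h2 : ∀ i, X i - a i ∈ vanishingIdeal (belowDegree σ 2)) (f : MvPowerSeries σ ℂ) :
    ∃ b : MvPowerSeries σ ℂ, subst a b = f := by
  set L : MvPowerSeries σ ℂ → MvPowerSeries σ ℂ := fun g => g - subst a g with hL
  have hs := hasSubst_of_zero ha
  have hit : ∀ n, L^[n] f ∈ vanishingIdeal (belowDegree σ n) := by
    intro n
    induction n with
    | zero => exact fun e he => absurd (show e.degree < 0 from he) (Nat.not_lt_zero _)
    | succ n ih =>
      rw [Function.iterate_succ_apply']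
      exact sub_subst_mem_belowDegree ha h2 n _ ih
  set S : ℕ → MvPowerSeries σ ℂ := fun n => ∑ k ∈ Finset.range n, L^[k] f with hS
  have hTS : ∀ n, subst a (S n) = f - L^[n] f := by
    intro n
    induction n with
    | zero =>
      have : S 0 = 0 := Finset.sum_range_zero _
      rw [this, Function.iterate_zero, id, sub_self, ← coe_substAlgHom hs, map_zero]
    | succ n ih =>
      have : S (n + 1) = S n + L^[n] f := Finset.sum_range_succ _ _
      rw [this, subst_add hs, ih, Function.iterate_succ_apply']
      simp only [hL]
      ring
  let b : MvPowerSeries σ ℂ := fun e => coeff e (S (e.degree + 1))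
  have hb : ∀ e, coeff e b = coeff e (S (e.degree + 1)) := fun e => rfl
  have hbS : ∀ n, b - S n ∈ vanishingIdeal (belowDegree σ n) := by
    intro n e he
    have he' : e.degree + 1 ≤ n := he
    rw [map_sub, hb, hS]
    simp only
    rw [← Finset.sum_range_add_sum_Ico _ he', map_add, sub_add_cancel_left, neg_eq_zero, map_sum]
    refine Finset.sum_eq_zero fun k hk => ?_
    exact hit k e (Finset.mem_Ico.1 hk).1
  refine ⟨b, sub_eq_zero.1 (eq_zero_of_forall_mem_belowDegree fun n => ?_)⟩
  have : subst a b - f = subst a (b - S n) - L^[n] f := by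
    rw [subst_sub hs, hTS]; ring
  rw [this]
  exact Ideal.sub_mem _ (subst_mem_belowDegree ha n _ (hbS n)) (hit n)

/-- The matrix of the linear terms of a formal map. -/
def linearPart (a : σ → MvPowerSeries σ ℂ) : Matrix σ σ ℂ :=
  Matrix.of fun i j => coeff (Finsupp.single j 1) (a i)

theorem linearPart_subst (a b : σ → MvPowerSeries σ ℂ) (hb : ∀ i, constantCoeff (b i) = 0) :
    linearPart (fun i => subst b (a i)) = linearPart a * linearPart b := by
  ext i j
  simp only [linearPart, Matrix.of_apply, Matrix.mul_apply, coeff_single_subst hb]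

theorem mem_belowDegree_two [DecidableEq τ] {f : MvPowerSeries τ ℂ} :
    f ∈ vanishingIdeal (belowDegree τ 2) ↔
      constantCoeff f = 0 ∧ ∀ i, coeff (Finsupp.single i 1) f = 0 := by
  constructor
  · intro h
    refine ⟨by simpa using h 0 (by change Finsupp.degree 0 < 2; simp), fun i => h _ ?_⟩
    change Finsupp.degree _ < 2
    simp
  · rintro ⟨h0, h1⟩ e he
    have he' : e.degree < 2 := he
    rcases Nat.lt_or_ge e.degree 1 with h | h
    · have : e = 0 := by simpa [Finsupp.degree_eq_zero_iff] using h
      rw [this, coeff_zero_eq_constantCoeff_apply, h0]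
    · have h' : e.degree = 1 := by omega
      obtain ⟨i, rfl⟩ := (Set.ext_iff.1 Finsupp.range_single_one e).2 h'
      exact h1 i

variable [DecidableEq σ]

/-- Composing with the inverse l of the linear part makes l ∘ a tangent to the identity; if b'
inverts l ∘ a on the left, then b' ∘ l inverts a. The determinant is recorded so that the result
applies again to the inverse. -/
theorem exists_left_inverse {a : σ → MvPowerSeries σ ℂ} (ha : ∀ i, constantCoeff (a i) = 0)
    (hdet : (linearPart a).det ≠ 0) :
    ∃ b : σ → MvPowerSeries σ ℂ, (∀ i, constantCoeff (b i) = 0) ∧ (linearPart b).det ≠ 0 ∧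
      ∀ i, subst a (b i) = X i := by
  set M := (linearPart a)⁻¹ with hM
  have hMa : M * linearPart a = 1 := Matrix.nonsing_inv_mul _ (isUnit_iff_ne_zero.2 hdet)
  set l : σ → MvPowerSeries σ ℂ := fun i => ∑ j, C (M i j) * X j with hl
  have hl0 : ∀ i, constantCoeff (l i) = 0 := by intro i; simp [hl]
  have hs := hasSubst_of_zero ha
  set a' : σ → MvPowerSeries σ ℂ := fun i => subst a (l i) with ha'
  have ha'0 : ∀ i, constantCoeff (a' i) = 0 := by
    intro i; rw [ha', constantCoeff_subst_of_zero ha, hl0]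
  have hll : linearPart l = M := by
    ext i j
    simp only [linearPart, hl, Matrix.of_apply, map_sum, coeff_C_mul]
    rw [Finset.sum_eq_single j]
    · simp
    · intro b _ hb
      rw [coeff_index_single_X, if_neg (Ne.symm hb), mul_zero]
    · simp
  have h2 : ∀ i, X i - a' i ∈ vanishingIdeal (belowDegree σ 2) := by
    intro i
    rw [mem_belowDegree_two]
    refine ⟨by simp [ha'0], fun j => ?_⟩
    have h3 : linearPart a' = 1 := by rw [ha', linearPart_subst l a ha, hll, hMa]
    have h4 := congrFun (congrFun h3 i) j
    simp only [linearPart, Matrix.of_apply] at h4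
    rw [map_sub, h4, coeff_index_single_X, Matrix.one_apply]
    simp [eq_comm]
  choose b' hb' using fun i => exists_left_inverse_of_tangent ha'0 h2 (X i)
  have hb : ∀ i, subst a (subst l (b' i)) = X i := by
    intro i
    rw [subst_subst hl0 ha]
    exact hb' i
  have hb0 : ∀ i, constantCoeff (subst l (b' i)) = 0 := by
    intro i
    rw [← constantCoeff_subst_of_zero ha, hb, constantCoeff_X]
  refine ⟨fun i => subst l (b' i), hb0, ?_, hb⟩
  have h5 := linearPart_subst (fun i => subst l (b' i)) a ha
  simp only [hb] at h5
  have h6 : linearPart (fun i => (X i : MvPowerSeries σ ℂ)) = 1 := by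
    ext i j
    simp only [linearPart, Matrix.of_apply]
    rw [coeff_index_single_X, Matrix.one_apply]
    simp [eq_comm]
  rw [h6] at h5
  intro h0
  have h7 := congrArg Matrix.det h5
  rw [Matrix.det_mul, h0, zero_mul, Matrix.det_one] at h7
  exact one_ne_zero h7

/-- The formal inverse function theorem. -/
theorem exists_inverse {a : σ → MvPowerSeries σ ℂ} (ha : ∀ i, constantCoeff (a i) = 0)
    (hdet : (linearPart a).det ≠ 0) :
    ∃ b : σ → MvPowerSeries σ ℂ, (∀ i, constantCoeff (b i) = 0) ∧
      (∀ i, subst a (b i) = X i) ∧ ∀ i, subst b (a i) = X i := by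
  obtain ⟨b, hb0, hb1, hb2⟩ := exists_left_inverse ha hdet
  -- The left inverse c of b satisfies c = c ∘ b ∘ a = a, so b is also a right inverse of a.
  obtain ⟨c, hc0, -, hc2⟩ := exists_left_inverse hb0 hb1
  refine ⟨b, hb0, hb2, fun i => ?_⟩
  have : c i = a i := by
    have h := congrArg (subst a) (hc2 i)
    rw [subst_subst hb0 ha, subst_X (hasSubst_of_zero ha)] at h
    simpa [hb2, subst_X_eq] using h
  rw [← this, hc2]

end Inverse

/-! ### Composition and inversion of maps between hypersurfaces. -/

section Complexification

/-- The composition `A ∘ B` of formal maps. -/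
def FormalMap.comp (A B : FormalMap) : FormalMap := fun i => subst B (A i)

theorem FormalMap.constantCoeff_comp {A B : FormalMap} (hA : ∀ i, constantCoeff (A i) = 0)
    (hB : ∀ i, constantCoeff (B i) = 0) (i : Fin 2) : constantCoeff (A.comp B i) = 0 := by
  rw [FormalMap.comp, constantCoeff_subst_of_zero hB, hA]

theorem constantCoeff_conjSeries {σ : Type} (f : MvPowerSeries σ ℂ) :
    constantCoeff (conjSeries f) = conj (constantCoeff f) := by
  rw [conjSeries, constantCoeff_map]

theorem FormalMap.constantCoeff_complexify {A : FormalMap} (hA : ∀ i, constantCoeff (A i) = 0)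
    (i : Fin 2 ⊕ Fin 2) : constantCoeff (A.complexify i) = 0 := by
  rcases i with i | i
  · simp [FormalMap.complexify, hA]
  · simp [FormalMap.complexify, constantCoeff_conjSeries, hA]

theorem subst_rename {σ τ υ : Type*} [Fintype σ] [Fintype τ] (e : σ → τ)
    {b : τ → MvPowerSeries υ ℂ} (hb : ∀ i, constantCoeff (b i) = 0) (f : MvPowerSeries σ ℂ) :
    subst b (rename e f) = subst (fun i => b (e i)) f := by
  rw [rename_eq_subst, subst_subst (by simp) hb]
  simp only [Function.comp_apply, subst_X (hasSubst_of_zero hb)]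

theorem rename_subst {σ τ υ : Type*} [Fintype σ] [Fintype τ] [Fintype υ] (e : τ → υ)
    {a : σ → MvPowerSeries τ ℂ} (ha : ∀ i, constantCoeff (a i) = 0) (f : MvPowerSeries σ ℂ) :
    rename e (subst a f) = subst (fun i => rename e (a i)) f := by
  rw [rename_eq_subst, subst_subst ha (by simp)]
  simp only [rename_eq_subst]

theorem conjSeries_subst {σ τ : Type} [Fintype σ] {a : σ → MvPowerSeries τ ℂ}
    (ha : ∀ i, constantCoeff (a i) = 0) (f : MvPowerSeries σ ℂ) :
    conjSeries (subst a f) = subst (fun i => conjSeries (a i)) (conjSeries f) :=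
  map_subst (hasSubst_of_zero ha) f

theorem FormalMap.complexify_inl (A : FormalMap) (i : Fin 2) :
    A.complexify (Sum.inl i) = rename Sum.inl (A i) := rfl

theorem FormalMap.complexify_inr (A : FormalMap) (i : Fin 2) :
    A.complexify (Sum.inr i) = rename Sum.inr (conjSeries (A i)) := rfl

theorem FormalMap.complexify_comp {A B : FormalMap}
    (hB : ∀ i, constantCoeff (B i) = 0) (i : Fin 2 ⊕ Fin 2) :
    (A.comp B).complexify i = subst B.complexify (A.complexify i) := by
  have hc := FormalMap.constantCoeff_complexify hB
  rcases i with i | i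
  · rw [complexify_inl, complexify_inl, subst_rename _ hc, FormalMap.comp, rename_subst _ hB]
    simp only [complexify_inl]
  · have hB' : ∀ i, constantCoeff (conjSeries (B i)) = 0 := fun i => by
      rw [constantCoeff_conjSeries, hB, map_zero]
    rw [complexify_inr, complexify_inr, subst_rename _ hc, FormalMap.comp, conjSeries_subst hB,
      rename_subst _ hB']
    simp only [complexify_inr]

theorem FormalMap.MapsInto.comp {A B : FormalMap} {R R' R'' : MvPowerSeries (Fin 2 ⊕ Fin 2) ℂ}
    (hA0 : ∀ i, constantCoeff (A i) = 0) (hB0 : ∀ i, constantCoeff (B i) = 0)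
    (hA : A.MapsInto R' R'') (hB : B.MapsInto R R') : (A.comp B).MapsInto R R'' := by
  have hBc := FormalMap.constantCoeff_complexify hB0
  have hAc := FormalMap.constantCoeff_complexify hA0
  have h : subst (A.comp B).complexify R'' = subst B.complexify (subst A.complexify R'') := by
    rw [subst_subst hAc hBc]
    simp only [← FormalMap.complexify_comp hB0]
  rw [FormalMap.MapsInto, h]
  refine dvd_trans hB ?_
  rw [← coe_substAlgHom (hasSubst_of_zero hBc)]
  exact map_dvd _ hA

theorem FormalMap.complexify_id : FormalMap.complexify (fun i => X i) = X := by
  funext i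
  rcases i with i | i
  · simp [FormalMap.complexify]
  · simp [FormalMap.complexify, conjSeries, map_X]

/-- The inverse of a formal equivalence of hypersurfaces is a formal equivalence. -/
theorem FormalMap.MapsInto.inverse {A B : FormalMap} {R R' : MvPowerSeries (Fin 2 ⊕ Fin 2) ℂ}
    (hA0 : ∀ i, constantCoeff (A i) = 0) (hB0 : ∀ i, constantCoeff (B i) = 0)
    (hAB : A.comp B = fun i => X i) (hA : A.MapsInto R R') (hR : constantCoeff R = 0)
    (hR' : ∃ i, coeff (Finsupp.single i 1) R' ≠ 0) : B.MapsInto R' R := by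
  have hBc := FormalMap.constantCoeff_complexify hB0
  have hAc := FormalMap.constantCoeff_complexify hA0
  have hs := hasSubst_of_zero hBc
  obtain ⟨U, hU⟩ := hA
  have h1 : R' = subst B.complexify R * subst B.complexify U := by
    rw [← subst_mul hs, ← hU, subst_subst hAc hBc]
    simp only [← FormalMap.complexify_comp hB0, hAB, FormalMap.complexify_id, subst_X_eq]
  -- R' = R(B) · U(B) has a nonzero linear term while R(B) has no constant term, so U must be a
  -- unit.
  have hU0 : constantCoeff U ≠ 0 := by
    intro h0
    obtain ⟨i, hi⟩ := hR'
    refine hi ?_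
    have h2 := mul_mem_belowDegree
      (mem_belowDegree_one.2 ((constantCoeff_subst_of_zero hBc R).trans hR))
      (mem_belowDegree_one.2 ((constantCoeff_subst_of_zero hBc U).trans h0))
    rw [← h1] at h2
    exact (mem_belowDegree_two.1 h2).2 i
  have hu : IsUnit (subst B.complexify U) := by
    rw [isUnit_iff_constantCoeff, constantCoeff_subst_of_zero hBc]
    exact isUnit_iff_ne_zero.2 hU0
  rw [FormalMap.MapsInto]
  nth_rewrite 1 [h1]
  obtain ⟨u, hu'⟩ := hu
  exact ⟨↑u⁻¹, by rw [← hu', mul_assoc, Units.mul_inv, mul_one]⟩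

end Complexification

/-! ### The symmetry conditions in an abstract differential ring. -/

section AbstractIdentities

variable {R : Type*} [CommRing R] [IsDomain R] [Algebra ℂ R]

-- Cancelling wᵖ⁺¹ in DG = Gᵖ⁺¹ σ DF leaves σ = ζ + wᵠ⁺¹(…). The bracket still contains σ, but there
-- σ may be replaced by ζ once one works modulo w.
omit [Algebra ℂ R] in
theorem slope_identity {p q : ℕ} {w ζ c V₁ e n σ DF DG G : R}
    (hw : w ≠ 0) (hG : G = w * (1 + w ^ (q + 1) * c))
    (hV : (1 + w ^ (q + 1) * c) ^ (p + 1) = 1 + w ^ (q + 1) * V₁)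
    (hDF : DF = 1 + w ^ (q + 1) * e) (hDG : DG = w ^ (p + 1) * (ζ + w ^ (q + 1) * n))
    (hE : DG = G ^ (p + 1) * σ * DF) :
    σ = ζ + w ^ (q + 1) * (n - (V₁ + e + w ^ (q + 1) * V₁ * e) * σ) := by
  rw [hDG, hG, mul_pow, hV, hDF] at hE
  refine mul_left_cancel₀ (pow_ne_zero (p + 1) hw) ?_
  linear_combination -hE

/-- The terms of order zero in the perturbation cancel because Dζ comes from the equation itself: ζ
= w'/wᵐ gives ζ' = Φ - m wᵐ⁻¹ ζ². What remains is divisible by wᵖ⁺¹ wᵠ⁺¹, and both factors can be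
cancelled. -/
theorem curvature_identity (D : Derivation ℂ R R) {p q : ℕ} {w ζ Φ Ψ c V₁ e σ σ₁ T DF G : R}
    (hw : w ≠ 0) (hDw : D w = w ^ (p + 1) * ζ)
    (hDζ : D ζ = Φ - (p + 1) * w ^ p * ζ ^ 2)
    (hG : G = w * (1 + w ^ (q + 1) * c))
    (hV : (1 + w ^ (q + 1) * c) ^ (p + 1) = 1 + w ^ (q + 1) * V₁)
    (hDF : DF = 1 + w ^ (q + 1) * e) (hσ : σ = ζ + w ^ (q + 1) * σ₁)
    (hΨ : Ψ = Φ + w ^ (q + 1) * T)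
    (hE : D (G ^ (p + 1) * σ) = G ^ (p + 1) * Ψ * DF) :
    (p + 1) * w ^ p * ζ * (V₁ * ζ + σ₁ + w ^ (q + 1) * V₁ * σ₁) +
      ((q + 1) * w ^ p * ζ * V₁ + D V₁) * σ + V₁ * (Φ - (p + 1) * w ^ p * ζ ^ 2) +
      (1 + w ^ (q + 1) * V₁) * ((q + 1) * w ^ p * ζ * σ₁ + D σ₁) - V₁ * Φ -
      (1 + w ^ (q + 1) * V₁) * (T + Φ * e + w ^ (q + 1) * T * e) = 0 := by
  rw [hG, mul_pow, hV, hΨ, hDF] at hE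
  have hone : D 1 = 0 := D.map_one_eq_zero
  have hDσ : D σ = Φ - (p + 1) * w ^ p * ζ ^ 2 +
      w ^ (q + 1) * ((q + 1) * w ^ p * ζ * σ₁ + D σ₁) := by
    rw [hσ]
    simp only [map_add, Derivation.leibniz, Derivation.leibniz_pow, smul_eq_mul, hDw, hDζ,
      nsmul_eq_mul, Nat.add_sub_cancel]
    push_cast
    ring
  have hDG : D (w ^ (p + 1) * (1 + w ^ (q + 1) * V₁) * σ) =
      w ^ (p + 1) * ((p + 1) * w ^ p * ζ * (1 + w ^ (q + 1) * V₁) * σ +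
        w ^ (q + 1) * ((q + 1) * w ^ p * ζ * V₁ + D V₁) * σ + (1 + w ^ (q + 1) * V₁) * D σ) := by
    simp only [map_add, Derivation.leibniz, Derivation.leibniz_pow, smul_eq_mul, hDw, hone,
      nsmul_eq_mul, Nat.add_sub_cancel]
    push_cast
    ring
  rw [hDG] at hE
  have hE' : (p + 1) * w ^ p * ζ * (1 + w ^ (q + 1) * V₁) * σ +
      w ^ (q + 1) * ((q + 1) * w ^ p * ζ * V₁ + D V₁) * σ + (1 + w ^ (q + 1) * V₁) * D σ =
      (1 + w ^ (q + 1) * V₁) * (Φ + w ^ (q + 1) * T) * (1 + w ^ (q + 1) * e) :=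
    mul_left_cancel₀ (pow_ne_zero (p + 1) hw) (by linear_combination hE)
  rw [hDσ] at hE'
  refine mul_left_cancel₀ (pow_ne_zero (q + 1) hw) ?_
  rw [hσ] at hE' ⊢
  linear_combination hE'

end AbstractIdentities

/-! ### Expansion in powers of ζ modulo w. -/

section Slices

/-- A series in `z`, regarded as a series in three variables. -/
def inFirst : PowerSeries ℂ →ₐ[ℂ] MvPowerSeries (Fin 3) ℂ :=
  rename (fun _ : Unit => (0 : Fin 3))

/-- The coefficient of `w⁰ ζʲ`, a series in `z`. -/
def slice (j : ℕ) (P : MvPowerSeries (Fin 3) ℂ) : PowerSeries ℂ :=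
  PowerSeries.mk fun i => coeff (expo i 0 j) P

theorem expo_zero (a b c : ℕ) : expo a b c 0 = a := rfl
theorem expo_one (a b c : ℕ) : expo a b c 1 = b := rfl
theorem expo_two (a b c : ℕ) : expo a b c 2 = c := rfl

theorem eq_expo (e : Fin 3 →₀ ℕ) : e = expo (e 0) (e 1) (e 2) := by
  ext i
  fin_cases i <;> rfl

theorem expo_eq_single (a : ℕ) : expo a 0 0 = Finsupp.single 0 a := by
  ext i
  fin_cases i <;> simp [expo]

theorem coeff_inFirst (p : PowerSeries ℂ) (a : ℕ) :
    coeff (expo a 0 0) (inFirst p) = PowerSeries.coeff a p := by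
  have h := coeff_embDomain_rename (R := ℂ)
    (⟨fun _ : Unit => (0 : Fin 3), fun _ _ _ => rfl⟩ : Unit ↪ Fin 3) p (Finsupp.single () a)
  rw [Finsupp.embDomain_single] at h
  rw [expo_eq_single]
  exact h

theorem coeff_inFirst_eq_zero (p : PowerSeries ℂ) (e : Fin 3 →₀ ℕ) (he : e 1 ≠ 0 ∨ e 2 ≠ 0) :
    coeff e (inFirst p) = 0 := by
  refine coeff_rename_eq_zero _ _ ?_
  rintro ⟨x, rfl⟩
  have h : ∀ j : Fin 3, j ≠ 0 → Finsupp.mapDomain (fun _ : Unit => (0 : Fin 3)) x j = 0 := by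
    intro j hj
    refine Finsupp.mapDomain_of_notMem_range _ _ ?_
    rintro ⟨_, h⟩
    exact hj h.symm
  rcases he with he | he
  · exact he (h 1 (by decide))
  · exact he (h 2 (by decide))

theorem slice_add (j : ℕ) (P Q : MvPowerSeries (Fin 3) ℂ) :
    slice j (P + Q) = slice j P + slice j Q := by
  ext i; simp [slice]

theorem slice_sub (j : ℕ) (P Q : MvPowerSeries (Fin 3) ℂ) :
    slice j (P - Q) = slice j P - slice j Q := by
  ext i; simp [slice]

theorem slice_X_one_mul (j : ℕ) (P : MvPowerSeries (Fin 3) ℂ) : slice j (X 1 * P) = 0 := by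
  ext i
  simp [slice, coeff_X_mul', expo_one]

theorem coeff_mul_X_two_pow (P : MvPowerSeries (Fin 3) ℂ) (n : ℕ) (e : Fin 3 →₀ ℕ) :
    coeff e (P * X 2 ^ n) = if n ≤ e 2 then coeff (expo (e 0) (e 1) (e 2 - n)) P else 0 := by
  rw [X_pow_eq, coeff_mul_monomial, mul_one]
  simp only [Finsupp.single_le_iff]
  split_ifs with h
  · congr 2
    ext i
    fin_cases i <;> simp [expo]
  · rfl

theorem slice_mul_X_two_pow (j n : ℕ) (P : MvPowerSeries (Fin 3) ℂ) :
    slice j (P * X 2 ^ n) = if n ≤ j then slice (j - n) P else 0 := by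
  ext i
  rw [slice, PowerSeries.coeff_mk, coeff_mul_X_two_pow, expo_zero, expo_one, expo_two]
  split_ifs <;> simp [slice]

theorem slice_inFirst (j : ℕ) (p : PowerSeries ℂ) :
    slice j (inFirst p) = if j = 0 then p else 0 := by
  ext i
  simp only [slice, PowerSeries.coeff_mk]
  split_ifs with h
  · rw [h, coeff_inFirst]
  · rw [coeff_inFirst_eq_zero _ _ (Or.inr h), map_zero]

theorem exists_of_slice_eq_zero (n : ℕ) (P : MvPowerSeries (Fin 3) ℂ)
    (h : ∀ j < n, slice j P = 0) : ∃ B A, P = B * X 2 ^ n + X 1 * A := by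
  let B : MvPowerSeries (Fin 3) ℂ := fun e => coeff (expo (e 0) (e 1) (e 2 + n)) P
  have hB : ∀ e, coeff e B = coeff (expo (e 0) (e 1) (e 2 + n)) P := fun _ => rfl
  have hd : X 1 ∣ P - B * X 2 ^ n := by
    rw [X_dvd_iff]
    intro e he
    rw [map_sub, coeff_mul_X_two_pow]
    split_ifs with hn
    · rw [hB, expo_zero, expo_one, expo_two, Nat.sub_add_cancel hn, ← eq_expo, sub_self]
    · have h1 := congrArg (fun x => PowerSeries.coeff (e 0) x) (h (e 2) (not_le.1 hn))
      rw [slice, PowerSeries.coeff_mk, (PowerSeries.coeff (e 0)).map_zero] at h1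
      rw [eq_expo e, he, h1, sub_zero]
  obtain ⟨A, hA⟩ := hd
  exact ⟨B, A, by rw [← hA]; ring⟩

theorem pderiv_zero_inFirst (p : PowerSeries ℂ) :
    pderiv ℂ 0 (inFirst p) = inFirst (PowerSeries.derivative ℂ p) := by
  have h0 : ∀ i : Unit, constantCoeff
    ((X ∘ (fun _ : Unit => (0 : Fin 3))) i : MvPowerSeries (Fin 3) ℂ) = 0 := by simp
  rw [inFirst, rename_eq_subst, pderiv_subst h0, rename_eq_subst]
  simp
  rfl

theorem pderiv_inFirst_of_ne (p : PowerSeries ℂ) (j : Fin 3) (hj : j ≠ 0) :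
    pderiv ℂ j (inFirst p) = 0 := by
  have h0 : ∀ i : Unit, constantCoeff
    ((X ∘ (fun _ : Unit => (0 : Fin 3))) i : MvPowerSeries (Fin 3) ℂ) = 0 := by simp
  rw [inFirst, rename_eq_subst, pderiv_subst h0]
  simp [pderiv_X_of_ne hj.symm]

/-- The terms of degree at most four in `ζ`, modulo `w`. -/
theorem exists_expansion (Φ : MvPowerSeries (Fin 3) ℂ)
    (hΦ : ∀ n : Fin 3 →₀ ℕ, n 2 < 2 → coeff n Φ = 0) :
    ∃ B A, Φ = inFirst (slice 2 Φ) * X 2 ^ 2 + inFirst (slice 3 Φ) * X 2 ^ 3 +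
      inFirst (slice 4 Φ) * X 2 ^ 4 + B * X 2 ^ 5 + X 1 * A := by
  have h0 : ∀ j < 2, slice j Φ = 0 := by
    intro j hj
    ext i
    rw [slice, PowerSeries.coeff_mk, hΦ _ hj, map_zero]
  obtain ⟨B, A, h⟩ := exists_of_slice_eq_zero 5 (Φ - (inFirst (slice 2 Φ) * X 2 ^ 2 +
    inFirst (slice 3 Φ) * X 2 ^ 3 + inFirst (slice 4 Φ) * X 2 ^ 4)) (by
      intro j hj
      simp only [slice_sub, slice_add, slice_mul_X_two_pow, slice_inFirst]
      interval_cases j <;> simp [h0])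
  exact ⟨B, A, by linear_combination h⟩

/-- The `P j` involve z alone, so they can be read off as the coefficients of w⁰ ζʲ; this extracts
four equations from one congruence. -/
theorem eq_zero_of_X_one_dvd (P : Fin 4 → PowerSeries ℂ) (B : MvPowerSeries (Fin 3) ℂ)
    (h : X 1 ∣ inFirst (P 0) + inFirst (P 1) * X 2 ^ 1 + inFirst (P 2) * X 2 ^ 2 +
      inFirst (P 3) * X 2 ^ 3 + B * X 2 ^ 4) (j : Fin 4) : P j = 0 := by
  obtain ⟨A, h⟩ := h
  have h1 := congrArg (slice j) h
  rw [slice_X_one_mul] at h1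
  simp only [slice_add, slice_mul_X_two_pow, slice_inFirst] at h1
  fin_cases j <;> simpa using h1

/-- A series without `ζ` is determined modulo `w` by a series in `z`. -/
theorem exists_eq_inFirst_add (P : MvPowerSeries (Fin 3) ℂ)
    (hP : ∀ n, coeff n P ≠ 0 → n 2 = 0) : ∃ A, P = inFirst (slice 0 P) + X 1 * A := by
  have hd : X 1 ∣ P - inFirst (slice 0 P) := by
    rw [X_dvd_iff]
    intro e he
    rw [map_sub]
    by_cases h2 : e 2 = 0
    · rw [eq_expo e, he, h2, coeff_inFirst, slice, PowerSeries.coeff_mk, sub_self]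
    · rw [coeff_inFirst_eq_zero _ _ (Or.inr h2), sub_zero]
      by_contra h
      exact h2 (hP e h)
  obtain ⟨A, hA⟩ := hd
  exact ⟨A, by rw [← hA]; ring⟩

theorem X_one_dvd_sub_C (a : MvPowerSeries (Fin 3) ℂ)
    (ha : ∀ n, coeff n a ≠ 0 → n 0 = 0 ∧ n 2 = 0) : X 1 ∣ a - C (constantCoeff a) := by
  rw [X_dvd_iff]
  intro n hn
  rw [map_sub, coeff_C]
  split_ifs with h0
  · rw [h0, coeff_zero_eq_constantCoeff_apply, sub_self]
  · rw [sub_zero]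
    by_contra h
    refine h0 ?_
    rw [eq_expo n, (ha n h).1, hn, (ha n h).2]
    ext i
    fin_cases i <;> rfl

theorem pderiv_eq_zero (j : Fin 3) (P : MvPowerSeries (Fin 3) ℂ)
    (hP : ∀ n, coeff n P ≠ 0 → n j = 0) : pderiv ℂ j P = 0 := by
  ext e
  rw [coeff_pderiv, map_zero]
  by_contra h
  have := hP _ (left_ne_zero_of_mul h)
  simp at this

end Slices

/-! ### The total derivative and reduction modulo w. -/

/-- Formal power series in three variables. -/
abbrev Series₃ : Type := MvPowerSeries (Fin 3) ℂ

instance isDomain_mvPowerSeries {σ : Type*} : IsDomain (MvPowerSeries σ ℂ) :=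
  NoZeroDivisors.to_isDomain _

theorem X_ne_zero {σ : Type*} (i : σ) : (X i : MvPowerSeries σ ℂ) ≠ 0 := by
  intro h
  have := congrArg (coeff (Finsupp.single i 1)) h
  simp [coeff_index_single_self_X] at this

/-- The total derivative along the solutions of `w'' = wᵐ Φ(z, w, w'/wᵐ)`, `m = p + 1`, in the
variables `z, w, ζ = w'/wᵐ`. -/
def totalDerivative (p : ℕ) (Φ : Series₃) :
    Derivation ℂ (Series₃) (Series₃) :=
  pderiv ℂ 0 + (X 1 ^ (p + 1) * X 2 : Series₃) • pderiv ℂ 1 +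
    (Φ - ((p : Series₃) + 1) * X 1 ^ p * X 2 ^ 2) • pderiv ℂ 2

theorem totalDerivative_apply (p : ℕ) (Φ P : Series₃) :
    totalDerivative p Φ P = pderiv ℂ 0 P + X 1 ^ (p + 1) * X 2 * pderiv ℂ 1 P +
      (Φ - ((p : Series₃) + 1) * X 1 ^ p * X 2 ^ 2) * pderiv ℂ 2 P := rfl

theorem totalDerivative_X_zero (p : ℕ) (Φ : Series₃) :
    totalDerivative p Φ (X 0) = 1 := by
  rw [totalDerivative_apply, pderiv_X_self, pderiv_X_of_ne (by decide), pderiv_X_of_ne (by decide)]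
  ring

theorem totalDerivative_X_one (p : ℕ) (Φ : Series₃) :
    totalDerivative p Φ (X 1) = X 1 ^ (p + 1) * X 2 := by
  rw [totalDerivative_apply, pderiv_X_self, pderiv_X_of_ne (by decide), pderiv_X_of_ne (by decide)]
  ring

theorem totalDerivative_X_two (p : ℕ) (Φ : Series₃) :
    totalDerivative p Φ (X 2) = Φ - ((p : Series₃) + 1) * X 1 ^ p * X 2 ^ 2 := by
  rw [totalDerivative_apply, pderiv_X_self, pderiv_X_of_ne (by decide), pderiv_X_of_ne (by decide)]
  ring

theorem totalDerivative_C (p : ℕ) (Φ : Series₃) (c : ℂ) :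
    totalDerivative p Φ (C c) = 0 := by
  simp [totalDerivative_apply]

theorem totalDerivative_inFirst (p : ℕ) (Φ : Series₃) (f : PowerSeries ℂ) :
    totalDerivative p Φ (inFirst f) = inFirst (PowerSeries.derivative ℂ f) := by
  rw [totalDerivative_apply, pderiv_zero_inFirst, pderiv_inFirst_of_ne _ _ (by decide),
    pderiv_inFirst_of_ne _ _ (by decide)]
  ring

theorem X_one_dvd_totalDerivative (p : ℕ) (Φ : Series₃)
    {P : Series₃} (h : X 1 ∣ P) : X 1 ∣ totalDerivative p Φ P := by
  obtain ⟨A, rfl⟩ := h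
  rw [Derivation.leibniz, totalDerivative_X_one]
  exact dvd_add (dvd_mul_right _ _) ⟨A * (X 1 ^ p * X 2), by rw [smul_eq_mul]; ring⟩

theorem inFirst_C (c : ℂ) : inFirst (PowerSeries.C c) = C c := rename_C _ c

/-- The quotient by the ideal generated by `w`. -/
abbrev modW : Series₃ →+*
    Series₃ ⧸ Ideal.span {(X 1 : Series₃)} :=
  Ideal.Quotient.mk _

theorem modW_eq_iff {P Q : Series₃} : modW P = modW Q ↔ X 1 ∣ P - Q := by
  rw [Ideal.Quotient.mk_eq_mk_iff_sub_mem, Ideal.mem_span_singleton]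

theorem modW_X_one : modW (X 1) = 0 :=
  Ideal.Quotient.eq_zero_iff_mem.2 (Ideal.mem_span_singleton_self _)

theorem modW_totalDerivative (p : ℕ) (Φ : Series₃)
    {P Q : Series₃} (h : modW P = modW Q) :
    modW (totalDerivative p Φ P) = modW (totalDerivative p Φ Q) := by
  rw [modW_eq_iff, ← map_sub] at *
  exact X_one_dvd_totalDerivative p Φ h

/-- `1` if `m = p + 1 = 1`, and `0` otherwise. -/
def simplePole (p : ℕ) : ℂ := if p = 0 then 1 else 0

theorem simplePole_sq (p : ℕ) : simplePole p * simplePole p = simplePole p := by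
  unfold simplePole; split_ifs <;> simp

theorem natCast_mul_simplePole (p : ℕ) : (p : ℂ) * simplePole p = 0 := by
  unfold simplePole; split_ifs with h <;> simp [h]

theorem modW_X_one_pow (p : ℕ) : modW (X 1 ^ p) = modW (C (simplePole p)) := by
  rcases p with _ | p
  · simp [simplePole]
  · rw [map_pow, modW_X_one, zero_pow (Nat.succ_ne_zero _)]
    simp [simplePole]

/-! ### The determining equations of a symmetry. -/

/-- The leading terms `a = a(0)`, `b = b(z, 0)`, `f = f(z, 0)` of a symmetry
`(z + wᵏ f, w + wᵏ⁺¹ a + wᵏ⁺ᵐ b)` of the equation, `k = q + 1` and `m = p + 1`, satisfy the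
equations `determiningTerms = 0`. Here `φⱼ` is the coefficient of `w⁰ ζʲ` in `Φ`. -/
def determiningTerms (p q : ℕ) (φ₂ φ₃ φ₄ : PowerSeries ℂ) (a : ℂ) (b f : PowerSeries ℂ) :
    Fin 4 → PowerSeries ℂ :=
  let d := PowerSeries.derivative ℂ
  let s : PowerSeries ℂ := PowerSeries.C ((q + 1 - p) * a) +
    PowerSeries.C (simplePole p * (q + 1)) * b - d f
  ![d (d b),
    PowerSeries.C (2 * (q + 2) * simplePole p) * d b - d (d f) - 2 * φ₂ * d b,
    PowerSeries.C ((q + 1) * simplePole p) * (s + PowerSeries.C a + b - d f) - φ₂ * s -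
      d φ₂ * f - 3 * φ₃ * d b - φ₂ * d f,
    -PowerSeries.C (q * (q + 1) * simplePole p) * f - 2 * φ₃ * s - d φ₃ * f - 4 * φ₄ * d b -
      φ₃ * d f - PowerSeries.C ((q + 1) * simplePole p) * φ₂ * f]

theorem fin3_X_add_eq (b : Fin 3 → Series₃) (t : Series₃) :
    (fun i => X i + t * b i) = ![X 0 + t * b 0, X 1 + t * b 1, X 2 + t * b 2] := by
  funext i
  fin_cases i <;> rfl

set_option maxHeartbeats 1000000 in
/-- The first order conditions on a symmetry of the equation. -/
theorem determiningTerms_eq_zero (p q : ℕ) (Φ F G σ a b f : Series₃)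
    (hΦ : ∀ n : Fin 3 →₀ ℕ, n 2 < 2 → coeff n Φ = 0)
    (ha : ∀ n, coeff n a ≠ 0 → n 0 = 0 ∧ n 2 = 0)
    (hb : ∀ n, coeff n b ≠ 0 → n 0 ≠ 0 ∧ n 2 = 0)
    (hf : ∀ n, coeff n f ≠ 0 → n 2 = 0)
    (hF : F = X 0 + X 1 ^ (q + 1) * f)
    (hG : G = X 1 + X 1 ^ (q + 2) * a + X 1 ^ (q + p + 2) * b)
    (hE₁ : totalDerivative p Φ G = G ^ (p + 1) * σ * totalDerivative p Φ F)
    (hE₂ : totalDerivative p Φ (G ^ (p + 1) * σ) =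
      G ^ (p + 1) * subst ![F, G, σ] Φ * totalDerivative p Φ F) (j : Fin 4) :
    determiningTerms p q (slice 2 Φ) (slice 3 Φ) (slice 4 Φ) (constantCoeff a) (slice 0 b)
      (slice 0 f) j = 0 := by
  set D := totalDerivative p Φ with hD
  set c : Series₃ := a + X 1 ^ p * b with hc
  have hG' : G = X 1 * (1 + X 1 ^ (q + 1) * c) := by rw [hG, hc]; ring
  obtain ⟨r, hr⟩ := Polynomial.powAddExpansion (1 : Series₃)
    (X 1 ^ (q + 1) * c) (p + 1)
  set V₁ : Series₃ := ((p : Series₃) + 1) * c + X 1 ^ (q + 1) * (r * c ^ 2) with hV₁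
  have hV : (1 + X 1 ^ (q + 1) * c) ^ (p + 1) = 1 + X 1 ^ (q + 1) * V₁ := by
    rw [hr, hV₁]; push_cast; ring
  have hw : (X 1 : Series₃) ≠ 0 := X_ne_zero _
  have hDw : D (X 1) = X 1 ^ (p + 1) * X 2 := totalDerivative_X_one p Φ
  have ha0 : pderiv ℂ 0 a = 0 := pderiv_eq_zero 0 a fun n h => (ha n h).1
  have ha2 : pderiv ℂ 2 a = 0 := pderiv_eq_zero 2 a fun n h => (ha n h).2
  have hb2 : pderiv ℂ 2 b = 0 := pderiv_eq_zero 2 b fun n h => (hb n h).2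
  have hf2 : pderiv ℂ 2 f = 0 := pderiv_eq_zero 2 f hf
  have hDa : D a = X 1 ^ (p + 1) * X 2 * pderiv ℂ 1 a := by
    rw [hD, totalDerivative_apply, ha0, ha2]; ring
  have hDb : D b = pderiv ℂ 0 b + X 1 ^ (p + 1) * X 2 * pderiv ℂ 1 b := by
    rw [hD, totalDerivative_apply, hb2]; ring
  have hDf : D f = pderiv ℂ 0 f + X 1 ^ (p + 1) * X 2 * pderiv ℂ 1 f := by
    rw [hD, totalDerivative_apply, hf2]; ring
  set e : Series₃ := pderiv ℂ 0 f +
    X 1 ^ p * X 2 * (((q : Series₃) + 1) * f + X 1 * pderiv ℂ 1 f) with he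
  have hDF : D F = 1 + X 1 ^ (q + 1) * e := by
    rw [hF, map_add, totalDerivative_X_zero, Derivation.leibniz, Derivation.leibniz_pow, hDw, hDf,
      he]
    simp only [smul_eq_mul, nsmul_eq_mul, Nat.add_sub_cancel]
    push_cast
    ring
  set n : Series₃ := ((q : Series₃) + 2) * X 2 * c + X 1 * X 2 * pderiv ℂ 1 a +
    (p : Series₃) * X 1 ^ p * X 2 * b + pderiv ℂ 0 b + X 1 ^ p * X 1 * X 2 * pderiv ℂ 1 b with hn
  have hDG : D G = X 1 ^ (p + 1) * (X 2 + X 1 ^ (q + 1) * n) := by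
    rw [hG, map_add, map_add, Derivation.leibniz, Derivation.leibniz, Derivation.leibniz_pow,
      Derivation.leibniz_pow, hDw, hDa, hDb, hn, hc]
    simp only [smul_eq_mul, nsmul_eq_mul]
    rw [show q + 2 - 1 = q + 1 by omega, show q + p + 2 - 1 = q + p + 1 by omega]
    push_cast
    ring
  set σ₁ := n - (V₁ + e + X 1 ^ (q + 1) * V₁ * e) * σ with hσ₁
  have hσ : σ = X 2 + X 1 ^ (q + 1) * σ₁ := slope_identity hw hG' hV hDF hDG hE₁
  -- Expand Φ(F, G, σ) about (z, w, ζ): the three increments are wᵠ⁺¹ times f, w a + wᵖ⁺¹ b and σ₁.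
  obtain ⟨t, ht⟩ := X_pow_dvd_taylor (j := (1 : Fin 3)) (n := q + 1)
    (a := fun i : Fin 3 => (X i : Series₃))
    (b := ![f, X 1 * a + X 1 ^ (p + 1) * b, σ₁]) (Nat.succ_ne_zero q) (by simp) Φ
  rw [fin3_X_add_eq, subst_X_eq] at ht
  simp only [subst_X_eq, Fin.sum_univ_three, Matrix.cons_val_zero, Matrix.cons_val_one,
    Matrix.cons_val_two, Matrix.tail_cons, Matrix.head_cons] at ht
  have hG2 : X 1 + X 1 ^ (q + 1) * (X 1 * a + X 1 ^ (p + 1) * b) = G := by rw [hG]; ring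
  rw [← hF, ← hσ, hG2] at ht
  set T := pderiv ℂ 0 Φ * f + pderiv ℂ 1 Φ * (X 1 * a + X 1 ^ (p + 1) * b) +
    pderiv ℂ 2 Φ * σ₁ + X 1 ^ (q + 1) * t with hT
  have hΨ : subst ![F, G, σ] Φ = Φ + X 1 ^ (q + 1) * T := by
    rw [hT]; linear_combination ht
  have key := curvature_identity D hw hDw (totalDerivative_X_two p Φ) hG' hV hDF hσ hΨ hE₂
  -- reduction modulo `w`
  obtain ⟨fA, hfA⟩ := exists_eq_inFirst_add f hf
  obtain ⟨bA, hbA⟩ := exists_eq_inFirst_add b fun n h => (hb n h).2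
  obtain ⟨aA, haA⟩ := X_one_dvd_sub_C a ha
  obtain ⟨B, A, hBA⟩ := exists_expansion Φ hΦ
  set A₀ := constantCoeff a
  set β := slice 0 b
  set fs := slice 0 f
  set φ₂ := slice 2 Φ
  set φ₃ := slice 3 Φ
  set φ₄ := slice 4 Φ
  set δ := simplePole p with hδ
  set d := PowerSeries.derivative ℂ with hd
  have mw : modW (X 1) = 0 := modW_X_one
  have mwq : modW (X 1) ^ (q + 1) = 0 := by rw [mw, zero_pow (Nat.succ_ne_zero _)]
  have mwp' : modW (X 1) ^ (p + 1) = 0 := by rw [mw, zero_pow (Nat.succ_ne_zero _)]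
  have mwp : modW (X 1) ^ p = modW (C δ) := by rw [← map_pow]; exact modW_X_one_pow p
  have hpδ : (p : Series₃ ⧸ Ideal.span {(X 1 : Series₃)}) * modW (C δ) = 0 := by
    rw [← map_natCast modW, ← map_mul, ← map_natCast (C (σ := Fin 3)), ← map_mul,
      natCast_mul_simplePole, map_zero, map_zero]
  have hδδ : modW (C δ) * modW (C δ) = modW (C δ) := by
    rw [← map_mul, ← map_mul, simplePole_sq]
  have mf : modW f = modW (inFirst fs) := modW_eq_iff.2 ⟨fA, by linear_combination hfA⟩
  have mb : modW b = modW (inFirst β) := modW_eq_iff.2 ⟨bA, by linear_combination hbA⟩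
  have ma : modW a = modW (C A₀) := modW_eq_iff.2 ⟨aA, haA⟩
  have mf0 : modW (pderiv ℂ 0 f) = modW (inFirst (d fs)) := by
    rw [hfA]
    simp [pderiv_X_of_ne, pderiv_zero_inFirst, mw, hd]
  have mb0 : modW (pderiv ℂ 0 b) = modW (inFirst (d β)) := by
    rw [hbA]
    simp [pderiv_X_of_ne, pderiv_zero_inFirst, mw, hd]
  have mσ : modW σ = modW (X 2) := by
    rw [hσ, map_add, map_mul, map_pow, mwq, zero_mul, add_zero]
  have mc : modW c = modW (C A₀) + modW (C δ) * modW (inFirst β) := by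
    rw [hc, map_add, map_mul, map_pow, ma, mb, mwp]
  have mV₁ : modW V₁ = (p + 1) * modW (C A₀) + modW (C δ) * modW (inFirst β) := by
    rw [hV₁]
    simp only [map_add, map_mul, map_pow, map_natCast, map_one, mc, mwq]
    linear_combination modW (inFirst β) * hpδ
  have me : modW e = modW (inFirst (d fs)) +
      (q + 1) * modW (C δ) * modW (X 2) * modW (inFirst fs) := by
    rw [he]
    simp only [map_add, map_mul, map_pow, map_natCast, map_one, mf, mf0, mwp]
    rw [mw]
    ring
  have mn : modW n = (q + 2) * modW (X 2) * (modW (C A₀) + modW (C δ) * modW (inFirst β)) +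
      modW (inFirst (d β)) := by
    rw [hn]
    simp only [map_add, map_mul, map_pow, map_natCast, map_ofNat, mc, mb, mb0, mwp]
    rw [mw]
    linear_combination modW (X 2) * modW (inFirst β) * hpδ
  set s : PowerSeries ℂ := PowerSeries.C ((q + 1 - p) * A₀) +
    PowerSeries.C (δ * (q + 1)) * β - d fs with hs
  set s₂ : PowerSeries ℂ := -PowerSeries.C ((q + 1) * δ) * fs with hs₂
  have hs' : modW (inFirst s) = (q + 1 - p) * modW (C A₀) +
      modW (C δ) * (q + 1) * modW (inFirst β) - modW (inFirst (d fs)) := by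
    rw [hs]
    simp only [map_add, map_sub, map_mul, map_natCast, map_one, inFirst_C]
  have hs₂' : modW (inFirst s₂) = -(q + 1) * modW (C δ) * modW (inFirst fs) := by
    rw [hs₂]
    simp only [map_add, map_mul, map_neg, map_natCast, map_one, inFirst_C]
    ring
  -- Modulo w the increment σ₁ of the slope is a quadratic polynomial in ζ with coefficients in z.
  set S : Series₃ := inFirst (d β) + inFirst s * X 2 + inFirst s₂ * X 2 ^ 2 with hS
  have mσ₁ : modW σ₁ = modW S := by
    rw [hσ₁, hS]
    simp only [map_add, map_sub, map_mul, map_pow, mn, mV₁, me, mσ, mwq, hs', hs₂']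
    ring
  have mDσ₁ := modW_totalDerivative p Φ mσ₁
  rw [← hD] at mDσ₁
  have hDV₁ : modW (D V₁) = modW (C δ) * modW (inFirst (d β)) := by
    have h : modW V₁ = modW (C ((p + 1) * A₀) + C δ * inFirst β) := by
      rw [mV₁]
      simp only [map_add, map_mul, map_natCast, map_one]
    have h' := modW_totalDerivative p Φ h
    rw [← hD] at h'
    rw [h', hD, map_add, Derivation.leibniz, totalDerivative_C, totalDerivative_C,
      totalDerivative_inFirst]
    simp [hd]
  have mΦ : modW Φ = modW (inFirst φ₂) * modW (X 2) ^ 2 + modW (inFirst φ₃) * modW (X 2) ^ 3 +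
      modW (inFirst φ₄) * modW (X 2) ^ 4 + modW B * modW (X 2) ^ 5 := by
    conv_lhs => rw [hBA]
    simp only [map_add, map_mul, map_pow, mw]
    ring
  have mΦ0 : modW (pderiv ℂ 0 Φ) = modW (inFirst (d φ₂)) * modW (X 2) ^ 2 +
      modW (inFirst (d φ₃)) * modW (X 2) ^ 3 +
      modW (inFirst (d φ₄)) * modW (X 2) ^ 4 + modW (pderiv ℂ 0 B) * modW (X 2) ^ 5 := by
    conv_lhs => rw [hBA]
    simp only [map_add, map_mul, map_pow, mw, Derivation.leibniz, Derivation.leibniz_pow,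
      pderiv_zero_inFirst, smul_eq_mul, pderiv_X_of_ne (show (2 : Fin 3) ≠ 0 by decide),
      pderiv_X_of_ne (show (1 : Fin 3) ≠ 0 by decide), smul_zero, mul_zero, map_zero, ← hd]
    ring
  have mΦ2 : modW (pderiv ℂ 2 Φ) = 2 * modW (inFirst φ₂) * modW (X 2) +
      3 * modW (inFirst φ₃) * modW (X 2) ^ 2 + 4 * modW (inFirst φ₄) * modW (X 2) ^ 3 +
      5 * modW B * modW (X 2) ^ 4 + modW (pderiv ℂ 2 B) * modW (X 2) ^ 5 := by
    conv_lhs => rw [hBA]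
    simp only [map_add, map_mul, map_pow, mw, Derivation.leibniz, Derivation.leibniz_pow,
      pderiv_inFirst_of_ne _ _ (show (2 : Fin 3) ≠ 0 by decide), smul_eq_mul, pderiv_X_self,
      pderiv_X_of_ne (show (1 : Fin 3) ≠ 2 by decide), mul_zero, map_zero, nsmul_eq_mul,
      map_natCast, map_one]
    push_cast
    ring
  have mT : modW T = modW (pderiv ℂ 0 Φ) * modW (inFirst fs) + modW (pderiv ℂ 2 Φ) * modW S := by
    rw [hT]
    simp only [map_add, map_mul, map_pow, mf, mσ₁, mw]
    ring
  have hds : d s = PowerSeries.C (δ * (q + 1)) * d β - d (d fs) := by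
    rw [hs, map_sub, map_add, Derivation.leibniz, hd, PowerSeries.derivative_C,
      PowerSeries.derivative_C]
    simp
  have hds₂ : d s₂ = -PowerSeries.C ((q + 1) * δ) * d fs := by
    rw [hs₂, neg_mul, map_neg, Derivation.leibniz, hd, PowerSeries.derivative_C]
    simp
  have mDS : modW (D S) = modW (inFirst (d (d β))) + modW (inFirst (d s)) * modW (X 2) +
      modW (inFirst s) * (modW Φ - modW (C δ) * modW (X 2) ^ 2) +
      modW (inFirst (d s₂)) * modW (X 2) ^ 2 +
      2 * modW (inFirst s₂) * modW (X 2) * (modW Φ - modW (C δ) * modW (X 2) ^ 2) := by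
    rw [hS, hD]
    simp only [map_add, map_sub, map_mul, map_pow, Derivation.leibniz, Derivation.leibniz_pow,
      totalDerivative_inFirst, totalDerivative_X_two, smul_eq_mul, nsmul_eq_mul, map_natCast,
      map_one, mwp, ← hd]
    push_cast
    linear_combination (-modW (inFirst s) * modW (X 2) ^ 2 -
      2 * modW (inFirst s₂) * modW (X 2) ^ 3) * hpδ
  -- The explicit cofactor collects the terms of order at least four in ζ. The unknown tail B ζ⁵ of
  -- Φ lands there entirely, since the ζ-derivative lowers its order by only one.
  refine eq_zero_of_X_one_dvd _ (2 * inFirst φ₃ * inFirst s₂ +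
    (inFirst φ₄ + B * X 2) * (inFirst s + 2 * X 2 * inFirst s₂) -
    (inFirst (d φ₄) + pderiv ℂ 0 B * X 2) * inFirst fs - 3 * inFirst φ₃ * inFirst s₂ -
    4 * inFirst φ₄ * (inFirst s + X 2 * inFirst s₂) - (5 * B + pderiv ℂ 2 B * X 2) * S -
    (inFirst φ₄ + B * X 2) * inFirst (d fs) +
    (inFirst φ₃ + inFirst φ₄ * X 2 + B * X 2 ^ 2) * inFirst s₂) ?_ j
  rw [← sub_zero (_ + _), ← modW_eq_iff, map_zero]
  simp only [determiningTerms, ← hδ, ← hd, ← hs, Matrix.cons_val_zero, Matrix.cons_val_one,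
    Matrix.cons_val_two, Matrix.cons_val_three, Matrix.tail_cons, Matrix.head_cons, pow_one]
  simp only [map_add, map_sub, map_mul, map_pow, map_neg, map_natCast, map_ofNat, map_one,
    inFirst_C, hS, hs₂']
  have key' := congrArg modW key
  simp only [map_add, map_sub, map_mul, map_pow, map_natCast, map_one, map_zero, mwq, mwp, mσ,
    mDσ₁.trans mDS, hDV₁, mT, me, mV₁, mσ₁] at key'
  simp only [hds, hds₂, hS, mΦ0, mΦ2, mΦ, map_add, map_sub, map_mul, map_pow, map_neg,
    map_natCast, map_one, inFirst_C, hs₂'] at key'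
  -- What is left is an identity in a commutative ring with the relations p u = 0 and u² = u, where
  -- u is the residue of wᵖ.
  generalize modW (inFirst s) = x₁ at key' hpδ hδδ ⊢
  generalize modW (inFirst fs) = x₂ at key' hpδ hδδ ⊢
  generalize modW (inFirst β) = x₃ at key' hpδ hδδ ⊢
  generalize modW (inFirst (d β)) = x₄ at key' hpδ hδδ ⊢
  generalize modW (inFirst (d fs)) = x₅ at key' hpδ hδδ ⊢
  generalize modW (inFirst (d (d β))) = x₆ at key' hpδ hδδ ⊢
  generalize modW (inFirst (d (d fs))) = x₇ at key' hpδ hδδ ⊢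
  generalize modW (inFirst φ₂) = y₂ at key' hpδ hδδ ⊢
  generalize modW (inFirst φ₃) = y₃ at key' hpδ hδδ ⊢
  generalize modW (inFirst φ₄) = y₄ at key' hpδ hδδ ⊢
  generalize modW (inFirst (d φ₂)) = z₂ at key' hpδ hδδ ⊢
  generalize modW (inFirst (d φ₃)) = z₃ at key' hpδ hδδ ⊢
  generalize modW (inFirst (d φ₄)) = z₄ at key' hpδ hδδ ⊢
  generalize modW (C δ) = u at key' hpδ hδδ ⊢
  generalize modW (C A₀) = v at key' hpδ hδδ ⊢
  generalize modW (X 2) = Z at key' hpδ hδδ ⊢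
  linear_combination key' - (Z * (x₄ + x₁ * Z - (q + 1) * u * x₂ * Z ^ 2) +
    (q + 1) * Z ^ 2 * v) * hpδ - ((q + 1) * Z ^ 2 * x₃ - q * (q + 1) * x₂ * Z ^ 3) * hδδ

/-! ### Cauchy data at the origin and nonresonance. -/

theorem constantCoeff_slice (j : ℕ) (Φ : Series₃) :
    PowerSeries.constantCoeff (slice j Φ) = coeff (expo 0 0 j) Φ := by
  rw [← PowerSeries.coeff_zero_eq_constantCoeff_apply, slice, PowerSeries.coeff_mk]

theorem constantCoeff_derivative (f : PowerSeries ℂ) :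
    PowerSeries.constantCoeff (PowerSeries.derivative ℂ f) = PowerSeries.coeff 1 f := by
  rw [← PowerSeries.coeff_zero_eq_constantCoeff_apply, PowerSeries.coeff_derivative]
  simp

theorem constantCoeff_derivative_derivative (f : PowerSeries ℂ) :
    PowerSeries.constantCoeff (PowerSeries.derivative ℂ (PowerSeries.derivative ℂ f)) =
      2 * PowerSeries.coeff 2 f := by
  rw [constantCoeff_derivative, PowerSeries.coeff_derivative]
  norm_num
  ring

theorem coeff_slice (i j : ℕ) (Φ : Series₃) :
    PowerSeries.coeff i (slice j Φ) = coeff (expo i 0 j) Φ := by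
  rw [slice, PowerSeries.coeff_mk]

theorem eq_zero_of_derivative_eq_zero {f : PowerSeries ℂ} (h : PowerSeries.derivative ℂ f = 0)
    (h0 : PowerSeries.constantCoeff f = 0) : f = 0 :=
  PowerSeries.derivative.ext (by rw [h, map_zero]) (by rw [h0, map_zero])

/-- The determining equations, in terms of the Cauchy data at the origin. -/
theorem cauchyData_equations {p q : ℕ} {Φ : Series₃} {a : ℂ} {b f : PowerSeries ℂ}
    (hb : PowerSeries.constantCoeff b = 0)
    (h : ∀ j, determiningTerms p q (slice 2 Φ) (slice 3 Φ) (slice 4 Φ) a b f j = 0) :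
    let δ := simplePole p
    let c := (q + 1 - p) * a
    let g₁ := PowerSeries.coeff 1 b
    let f₀ := PowerSeries.constantCoeff f
    let f₁ := PowerSeries.coeff 1 f
    (q + 1) * δ * (c + a - 2 * f₁) - alpha Φ 0 * c - alpha Φ 1 * f₀ - 3 * beta Φ 0 * g₁ = 0 ∧
    -(q * (q + 1) * δ) * f₀ - 2 * beta Φ 0 * (c - f₁) - beta Φ 1 * f₀ - 4 * gamma Φ 0 * g₁ -
      beta Φ 0 * f₁ - (q + 1) * δ * alpha Φ 0 * f₀ = 0 ∧
    (q + 1) * δ * ((q + 1) * δ * g₁ + g₁ - 2 * (2 * (q + 2) * δ - 2 * alpha Φ 0) * g₁) -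
      alpha Φ 1 * c - alpha Φ 0 * ((q + 1) * δ * g₁) - 2 * alpha Φ 2 * f₀ - alpha Φ 1 * f₁ -
      3 * beta Φ 1 * g₁ = 0 ∧
    -(q * (q + 1) * δ) * f₁ - 2 * beta Φ 1 * c - 2 * beta Φ 0 * ((q + 1) * δ * g₁) +
      beta Φ 0 * ((2 * (q + 2) * δ - 2 * alpha Φ 0) * g₁) - 2 * beta Φ 2 * f₀ -
      4 * gamma Φ 1 * g₁ - (q + 1) * δ * (alpha Φ 1 * f₀ + alpha Φ 0 * f₁) = 0 := by
  intro δ c g₁ f₀ f₁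
  have e2 : (2 : PowerSeries ℂ) = PowerSeries.C 2 := (map_ofNat _ 2).symm
  have e3 : (3 : PowerSeries ℂ) = PowerSeries.C 3 := (map_ofNat _ 3).symm
  have e4 : (4 : PowerSeries ℂ) = PowerSeries.C 4 := (map_ofNat _ 4).symm
  have h0 := congrArg PowerSeries.constantCoeff (h 0)
  have h1 := congrArg PowerSeries.constantCoeff (h 1)
  have h2 := congrArg PowerSeries.constantCoeff (h 2)
  have h3 := congrArg PowerSeries.constantCoeff (h 3)
  have h2' := congrArg (fun x => PowerSeries.constantCoeff (PowerSeries.derivative ℂ x)) (h 2)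
  have h3' := congrArg (fun x => PowerSeries.constantCoeff (PowerSeries.derivative ℂ x)) (h 3)
  simp only [determiningTerms, Matrix.cons_val_zero, Matrix.cons_val_one, Matrix.cons_val_two,
    Matrix.cons_val_three, Matrix.tail_cons, Matrix.head_cons, e2, e3, e4, map_add, map_sub,
    map_mul, map_neg, map_zero, Derivation.leibniz, smul_eq_mul,
    PowerSeries.derivative_C, PowerSeries.constantCoeff_C, constantCoeff_slice,
    constantCoeff_derivative_derivative, mul_zero, zero_add, add_zero, neg_mul] at h0 h1 h2 h3 h2' h3'
  simp only [constantCoeff_derivative, coeff_slice, hb] at h0 h1 h2 h3 h2' h3'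
  simp only [alpha, beta, gamma]
  refine ⟨?_, ?_, ?_, ?_⟩
  · linear_combination h2
  · linear_combination h3
  -- The differentiated equations contain b''(0) and f''(0); the first two determining equations
  -- eliminate them.
  · linear_combination h2' - 2 * (q + 1) * δ * h1 + 3 * coeff (expo 0 0 3) Φ * h0
  · linear_combination h3' + coeff (expo 0 0 3) Φ * h1 + 4 * coeff (expo 0 0 4) Φ * h0

theorem mulVec_fin_four (M : Matrix (Fin 4) (Fin 4) ℂ) (v : Fin 4 → ℂ) (i : Fin 4) :
    M.mulVec v i = M i 0 * v 0 + M i 1 * v 1 + M i 2 * v 2 + M i 3 * v 3 := by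
  simp [Matrix.mulVec, dotProduct, Fin.sum_univ_four]

/-- Nonresonance forces the Cauchy data of a symmetry to vanish. -/
theorem cauchyData_eq_zero {p q : ℕ} {Φ : Series₃} {c g₁ f₀ f₁ a : ℂ}
    (hres : IsNonResonantODE (p + 1) Φ) (hc : c = (q + 1 - p) * a)
    (h1 : (q + 1) * simplePole p * (c + a - 2 * f₁) - alpha Φ 0 * c - alpha Φ 1 * f₀ -
      3 * beta Φ 0 * g₁ = 0)
    (h2 : -(q * (q + 1) * simplePole p) * f₀ - 2 * beta Φ 0 * (c - f₁) - beta Φ 1 * f₀ -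
      4 * gamma Φ 0 * g₁ - beta Φ 0 * f₁ - (q + 1) * simplePole p * alpha Φ 0 * f₀ = 0)
    (h3 : (q + 1) * simplePole p * ((q + 1) * simplePole p * g₁ + g₁ -
      2 * (2 * (q + 2) * simplePole p - 2 * alpha Φ 0) * g₁) -
      alpha Φ 1 * c - alpha Φ 0 * ((q + 1) * simplePole p * g₁) - 2 * alpha Φ 2 * f₀ -
      alpha Φ 1 * f₁ - 3 * beta Φ 1 * g₁ = 0)
    (h4 : -(q * (q + 1) * simplePole p) * f₁ - 2 * beta Φ 1 * c -
      2 * beta Φ 0 * ((q + 1) * simplePole p * g₁) +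
      beta Φ 0 * ((2 * (q + 2) * simplePole p - 2 * alpha Φ 0) * g₁) - 2 * beta Φ 2 * f₀ -
      4 * gamma Φ 1 * g₁ - (q + 1) * simplePole p * (alpha Φ 1 * f₀ + alpha Φ 0 * f₁) = 0) :
    c = 0 ∧ g₁ = 0 ∧ f₀ = 0 ∧ f₁ = 0 := by
  rcases p with _ | p
  · have hδ : simplePole 0 = 1 := if_pos rfl
    rw [hδ] at h1 h2 h3 h4
    have hc' : c = (q + 1) * a := by rw [hc]; push_cast; ring
    have hq : (q + 1 : ℂ) ≠ 0 := Nat.cast_add_one_ne_zero q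
    set v : Fin 4 → ℂ := ![a, g₁, f₀, f₁] with hv
    by_contra hne
    have hv0 : v ≠ 0 := by
      intro h
      refine hne ⟨?_, congrFun h 1, congrFun h 2, congrFun h 3⟩
      have ha : a = 0 := congrFun h 0
      rw [hc', ha, mul_zero]
    -- A term wᵏ v in the Cauchy data, k = q + 1, solves the linearized first order system with w H'
    -- = k wᵏ v, so (v, k v) is an eigenvector with eigenvalue k.
    refine hres.1 rfl (q + 1) (Nat.succ_pos q) (Module.End.hasEigenvalue_of_hasEigenvector
      (x := Sum.elim v (fun i => (q + 1) * v i)) ⟨?_, ?_⟩)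
    · rw [Module.End.mem_eigenspace_iff, Matrix.toLin'_apply, cauchyMatrix,
        Matrix.fromBlocks_mulVec]
      funext i
      rcases i with i | i
      · simp [Function.comp_def]
      · rw [hc'] at h1 h2 h3 h4
        simp only [Matrix.add_mulVec, Matrix.one_mulVec, Sum.elim_inr, Function.comp_def,
          Sum.elim_inl, Pi.add_apply, Pi.smul_apply, smul_eq_mul, mulVec_fin_four]
        fin_cases i
        · simp [cauchyMatrixH, cauchyMatrixG, hv]
          linear_combination -h1
        · simp [cauchyMatrixH, cauchyMatrixG, hv]
          linear_combination h3 / 3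
        · simp [cauchyMatrixH, cauchyMatrixG, hv]
          linear_combination h2
        · simp [cauchyMatrixH, cauchyMatrixG, hv]
          linear_combination h4
    · intro h
      exact hv0 (funext fun i => congrFun h (Sum.inl i))
  · have hδ : simplePole (p + 1) = 0 := if_neg (Nat.succ_ne_zero p)
    rw [hδ] at h1 h2 h3 h4
    have hu := (hres.2 (by omega)).1
    -- For m > 1 all terms containing `simplePole` drop out, and the four equations become a kernel
    -- condition on the resonance matrix.
    have hz : (resonanceMatrix Φ).mulVec ![c, g₁, f₀, f₁] = 0 := by
      funext i
      fin_cases i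
      · simp [Matrix.mulVec, dotProduct, Fin.sum_univ_four, resonanceMatrix]
        linear_combination -h1
      · simp [Matrix.mulVec, dotProduct, Fin.sum_univ_four, resonanceMatrix]
        linear_combination -h3
      · simp [Matrix.mulVec, dotProduct, Fin.sum_univ_four, resonanceMatrix]
        linear_combination -h2
      · simp [Matrix.mulVec, dotProduct, Fin.sum_univ_four, resonanceMatrix]
        linear_combination -h4
    have h0 : ![c, g₁, f₀, f₁] = 0 :=
      Matrix.mulVec_injective_of_isUnit hu (by rw [hz, Matrix.mulVec_zero])
    exact ⟨congrFun h0 0, congrFun h0 1, congrFun h0 2, congrFun h0 3⟩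

/-- Once the Cauchy data vanish, b'' = 0 forces b = 0, and then f'' = 0 forces f = 0. For a only the
product with q + 1 - p is controlled, so the order q + 1 = p stays open. -/
theorem leading_terms_eq_zero {p q : ℕ} {Φ : Series₃} {a : ℂ} {b f : PowerSeries ℂ}
    (hres : IsNonResonantODE (p + 1) Φ) (hb : PowerSeries.constantCoeff b = 0)
    (h : ∀ j, determiningTerms p q (slice 2 Φ) (slice 3 Φ) (slice 4 Φ) a b f j = 0) :
    (q + 1 - p) * a = 0 ∧ b = 0 ∧ f = 0 := by
  obtain ⟨h1, h2, h3, h4⟩ := cauchyData_equations hb h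
  obtain ⟨hc, hg, hf0, hf1⟩ := cauchyData_eq_zero hres rfl h1 h2 h3 h4
  have hdb : PowerSeries.derivative ℂ b = 0 :=
    eq_zero_of_derivative_eq_zero (h 0) (by rw [constantCoeff_derivative, hg])
  have hddf : PowerSeries.derivative ℂ (PowerSeries.derivative ℂ f) = 0 := by
    have := h 1
    simp only [determiningTerms, Matrix.cons_val_one, hdb, mul_zero, zero_sub, sub_zero,
      Matrix.cons_val_zero] at this
    exact neg_eq_zero.1 this
  refine ⟨hc, eq_zero_of_derivative_eq_zero hdb hb, eq_zero_of_derivative_eq_zero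
    (eq_zero_of_derivative_eq_zero hddf (by rw [constantCoeff_derivative, hf1])) hf0⟩

/-! ### Induction on the order of contact along w = 0. -/

theorem coeff_add_single_X_pow_mul {σ : Type*} (i : σ) (k : ℕ) (n : σ →₀ ℕ)
    (A : MvPowerSeries σ ℂ) : coeff (n + Finsupp.single i k) (X i ^ k * A) = coeff n A := by
  rw [X_pow_eq, add_comm n, coeff_add_monomial_mul, one_mul]

theorem entry_eq_zero_of_X_pow_mul {k : ℕ} {j : Fin 3} (hj : j ≠ 1) {A : Series₃}
    (h : ∀ n, coeff n A ≠ 0 → n j = 0) (n : Fin 3 →₀ ℕ) (hn : coeff n (X 1 ^ k * A) ≠ 0) :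
    n j = 0 := by
  rw [X_pow_eq, coeff_monomial_mul, one_mul] at hn
  split_ifs at hn with hk
  · have := h _ hn
    rw [Finsupp.tsub_apply, Finsupp.single_apply, if_neg (Ne.symm hj), Nat.sub_zero] at this
    exact this
  · exact absurd rfl hn

theorem eq_of_forall_X_pow_dvd {σ : Type*} (i : σ) {A B : MvPowerSeries σ ℂ}
    (h : ∀ k : ℕ, X i ^ (k + 1) ∣ A - B) : A = B := by
  ext e
  have := X_pow_dvd_iff.1 (h (e i)) e (Nat.lt_succ_self _)
  rwa [map_sub, sub_eq_zero] at this

/-- A symmetry of a nonresonant equation that is tangent to the identity to the order of the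
initial conditions is the identity. -/
theorem eq_X_of_symmetry (p : ℕ) (Φ F G σ : Series₃)
    (hΦ : ∀ n : Fin 3 →₀ ℕ, n 2 < 2 → coeff n Φ = 0) (hres : IsNonResonantODE (p + 1) Φ)
    (hF2 : ∀ n, coeff n F ≠ 0 → n 2 = 0) (hG2 : ∀ n, coeff n G ≠ 0 → n 2 = 0)
    (hF : X 1 ∣ F - X 0) (hG : X 1 ^ (p + 2) ∣ G - X 1)
    (hE₁ : totalDerivative p Φ G = G ^ (p + 1) * σ * totalDerivative p Φ F)
    (hE₂ : totalDerivative p Φ (G ^ (p + 1) * σ) =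
      G ^ (p + 1) * subst ![F, G, σ] Φ * totalDerivative p Φ F) : F = X 0 ∧ G = X 1 := by
  have main : ∀ q : ℕ, ∃ a b f : Series₃, (∀ n, coeff n a ≠ 0 → n 0 = 0 ∧ n 2 = 0) ∧
      (∀ n, coeff n b ≠ 0 → n 0 ≠ 0 ∧ n 2 = 0) ∧ (∀ n, coeff n f ≠ 0 → n 2 = 0) ∧
      F = X 0 + X 1 ^ (q + 1) * f ∧ G = X 1 + X 1 ^ (q + 2) * a + X 1 ^ (q + p + 2) * b := by
    intro q
    induction q with
    | zero =>
      obtain ⟨f, hf⟩ := hF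
      obtain ⟨g, hg⟩ := hG
      have hX : ∀ (i : Fin 3), i ≠ 2 → ∀ n : Fin 3 →₀ ℕ, n 2 ≠ 0 → coeff n (X i : Series₃) = 0 := by
        intro i hi n hn
        rw [coeff_X, if_neg]
        rintro rfl
        exact hn (by rw [Finsupp.single_apply, if_neg hi])
      have hf2 : ∀ n, coeff n f ≠ 0 → n 2 = 0 := by
        intro n hn
        by_contra h2
        have h2' : (n + Finsupp.single 1 1 : Fin 3 →₀ ℕ) 2 ≠ 0 := by simpa using h2
        rw [← coeff_add_single_X_pow_mul 1 1, pow_one, ← hf, map_sub, hX 0 (by decide) _ h2',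
          sub_zero] at hn
        exact h2' (hF2 _ hn)
      have hg2 : ∀ n, coeff n g ≠ 0 → n 2 = 0 := by
        intro n hn
        by_contra h2
        have h2' : (n + Finsupp.single 1 (p + 2) : Fin 3 →₀ ℕ) 2 ≠ 0 := by simpa using h2
        rw [← coeff_add_single_X_pow_mul 1 (p + 2), ← hg, map_sub, hX 1 (by decide) _ h2',
          sub_zero] at hn
        exact h2' (hG2 _ hn)
      -- Split g into its value on z = 0 and a remainder vanishing there. For q = 0 the term wᵖ⁺² g₀
      -- is w² a with a = wᵖ g₀, while the remainder has the right exponent for b.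
      let g₀ : Series₃ := fun n => if n 0 = 0 then coeff n g else 0
      have hg₀ : ∀ n, coeff n g₀ = if n 0 = 0 then coeff n g else 0 := fun _ => rfl
      have hg₀0 : ∀ n, coeff n g₀ ≠ 0 → n 0 = 0 := by
        intro n hn
        by_contra h
        rw [hg₀, if_neg h] at hn
        exact hn rfl
      have hg₀2 : ∀ n, coeff n g₀ ≠ 0 → n 2 = 0 := by
        intro n hn
        rw [hg₀, if_pos (hg₀0 n hn)] at hn
        exact hg2 n hn
      refine ⟨X 1 ^ p * g₀, g - g₀, f, fun n hn =>
        ⟨entry_eq_zero_of_X_pow_mul (by decide) hg₀0 n hn,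
          entry_eq_zero_of_X_pow_mul (by decide) hg₀2 n hn⟩, fun n hn => ?_, hf2, ?_, ?_⟩
      · rw [map_sub, hg₀] at hn
        split_ifs at hn with h0
        · exact absurd (sub_self _) hn
        · exact ⟨h0, hg2 n (by rwa [sub_zero] at hn)⟩
      · linear_combination hf
      · rw [zero_add, zero_add]
        linear_combination hg
    | succ q ih =>
      obtain ⟨a, b, f, ha, hb, hf, hF', hG'⟩ := ih
      have hdet := determiningTerms_eq_zero p q Φ F G σ a b f hΦ ha hb hf hF' hG' hE₁ hE₂
      have hb0 : PowerSeries.constantCoeff (slice 0 b) = 0 := by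
        rw [constantCoeff_slice]
        by_contra h
        exact (hb _ h).1 rfl
      obtain ⟨h1, h2, h3⟩ := leading_terms_eq_zero hres hb0 hdet
      obtain ⟨bA, hbA⟩ := exists_eq_inFirst_add b fun n h => (hb n h).2
      obtain ⟨fA, hfA⟩ := exists_eq_inFirst_add f hf
      rw [h2, map_zero, zero_add] at hbA
      rw [h3, map_zero, zero_add] at hfA
      -- In the exceptional order q + 1 = p the equation says nothing about a(0). There wᵠ⁺² = wᵐ,
      -- so the hypothesis G ≡ w modulo wᵐ⁺¹ gives a(0) = 0.
      obtain ⟨aA, haA⟩ : X 1 ∣ a := by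
        rcases mul_eq_zero.1 h1 with hp | h0
        · have hp' : p = q + 1 := by
            have : ((q + 1 : ℕ) : ℂ) = p := by push_cast; linear_combination hp
            exact (Nat.cast_injective this).symm
          obtain ⟨g, hg⟩ := hG
          have : X 1 ^ (q + 2) * a = X 1 ^ (q + 2) * (X 1 * (g - X 1 ^ q * b)) := by
            rw [hp'] at hG' hg
            linear_combination hg - hG'
          exact ⟨_, mul_left_cancel₀ (pow_ne_zero _ (X_ne_zero 1)) this⟩
        · have := X_one_dvd_sub_C a ha
          rwa [h0, map_zero, sub_zero] at this
      have hshift : ∀ (A : Series₃) (n : Fin 3 →₀ ℕ), coeff n A ≠ 0 →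
          coeff (n + Finsupp.single 1 1) (X 1 * A) ≠ 0 := by
        intro A n hn
        have := coeff_add_single_X_pow_mul 1 1 n A
        rw [pow_one] at this
        rwa [this]
      have hs : ∀ j : Fin 3, j ≠ 1 → ∀ n : Fin 3 →₀ ℕ,
          n j = (n + Finsupp.single 1 1 : Fin 3 →₀ ℕ) j := by
        intro j hj n
        rw [Finsupp.add_apply, Finsupp.single_apply, if_neg (Ne.symm hj), add_zero]
      refine ⟨aA, bA, fA, fun n hn => ?_, fun n hn => ?_, fun n hn => ?_, ?_, ?_⟩
      · rw [hs 0 (by decide), hs 2 (by decide)]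
        exact ha _ (by rw [haA]; exact hshift aA n hn)
      · rw [hs 0 (by decide), hs 2 (by decide)]
        exact hb _ (by rw [hbA]; exact hshift bA n hn)
      · rw [hs 2 (by decide)]
        exact hf _ (by rw [hfA]; exact hshift fA n hn)
      · rw [hF', hfA]; ring
      · rw [hG', haA, hbA]; ring
  constructor
  · refine eq_of_forall_X_pow_dvd 1 fun q => ?_
    obtain ⟨a, b, f, -, -, -, hF', -⟩ := main q
    exact ⟨f, by rw [hF']; ring⟩
  · refine eq_of_forall_X_pow_dvd 1 fun q => ?_
    obtain ⟨a, b, f, -, -, -, -, hG'⟩ := main q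
    exact ⟨X 1 * a + X 1 ^ (p + 1) * b, by rw [hG']; ring⟩

/-! ### Cancelling factors in divisibility statements. -/

section Divisibility

variable {σ : Type*}

/-- Modulo X_i the factor A is a power of another variable, which is not a zero divisor there. It
serves to divide by Θᵐ, congruent to τᵐ modulo χ. -/
theorem X_dvd_of_X_dvd_mul {i : σ} {A B : MvPowerSeries σ ℂ}
    (hA : ∃ j k, j ≠ i ∧ X i ∣ A - X j ^ k) (h : X i ∣ A * B) : X i ∣ B := by
  classical
  obtain ⟨j, k, hj, hd⟩ := hA
  have h1 : X i ∣ X j ^ k * B := by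
    have := dvd_sub h (hd.mul_right B)
    rwa [show A * B - (A - X j ^ k) * B = X j ^ k * B by ring] at this
  rw [X_dvd_iff] at h1 ⊢
  intro n hn
  rw [← coeff_add_single_X_pow_mul j k n B]
  refine h1 _ ?_
  rw [Finsupp.add_apply, hn, Finsupp.single_apply, if_neg hj, add_zero]

theorem isUnit_of_constantCoeff_ne_zero {A : MvPowerSeries σ ℂ} (h : constantCoeff A ≠ 0) :
    IsUnit A := isUnit_iff_constantCoeff.2 (isUnit_iff_ne_zero.2 h)

theorem X_pow_dvd_of_X_pow_dvd_mul_unit {i : σ} {n : ℕ} {A B : MvPowerSeries σ ℂ}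
    (hA : constantCoeff A ≠ 0) (h : X i ^ n ∣ A * B) : X i ^ n ∣ B :=
  (isUnit_of_constantCoeff_ne_zero hA).dvd_mul_left.1 h

end Divisibility

/-! ### Normal form and Segre varieties. -/

section Admissible

/-- The part of the normal form of an admissible hypersurface that is used below. -/
def IsNormalForm (p : ℕ) (c : ℂ) (g h : Series₃) : Prop :=
  h = X 2 ^ (p + 1) * (C c * X 0 * X 1 + X 1 ^ 2 * g)

theorem IsAdmissible.exists_normalForm {p : ℕ} {h : Series₃} (hh : IsAdmissible (p + 1) h) :
    ∃ c g, c ≠ 0 ∧ IsNormalForm p c g h := by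
  obtain ⟨ε, g, hε, -, hg, -, rfl⟩ := hh
  obtain ⟨g', hg'⟩ : X 1 ^ 2 ∣ g := by
    rw [X_pow_dvd_iff]
    intro n hn
    rw [eq_expo n]
    exact hg _ _ _ (Or.inr hn)
  refine ⟨1 / 2 * ε, C (1 / 2) * g', ?_, ?_⟩
  · rcases hε with rfl | rfl <;> norm_num
  · rw [IsNormalForm, hg', smul_eq_C_mul, smul_eq_C_mul, map_mul]
    ring

variable {p : ℕ} {c : ℂ} {g h : Series₃}

theorem vec3_constantCoeff {σ : Type*} {x y u : MvPowerSeries σ ℂ} (hx : constantCoeff x = 0)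
    (hy : constantCoeff y = 0) (hu : constantCoeff u = 0) (i : Fin 3) :
    constantCoeff ((![x, y, u] : Fin 3 → MvPowerSeries σ ℂ) i) = 0 := by
  fin_cases i <;> assumption

theorem vec2_constantCoeff {σ : Type*} {x y : MvPowerSeries σ ℂ} (hx : constantCoeff x = 0)
    (hy : constantCoeff y = 0) (i : Fin 2) :
    constantCoeff ((![x, y] : Fin 2 → MvPowerSeries σ ℂ) i) = 0 := by
  fin_cases i <;> assumption

theorem IsNormalForm.subst_eq {σ : Type*} (hn : IsNormalForm p c g h)
    {x y u : MvPowerSeries σ ℂ} (hx : constantCoeff x = 0)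
    (hy : constantCoeff y = 0) (hu : constantCoeff u = 0) :
    subst ![x, y, u] h = u ^ (p + 1) * (C c * x * y + y ^ 2 * subst ![x, y, u] g) := by
  have hs := hasSubst_of_zero (vec3_constantCoeff hx hy hu)
  rw [IsNormalForm] at hn
  rw [hn, ← coe_substAlgHom hs]
  simp only [map_mul, map_add, map_pow, coe_substAlgHom, subst_C, subst_X hs,
    Matrix.cons_val_zero, Matrix.cons_val_one, Matrix.cons_val_two, Matrix.tail_cons,
    Matrix.head_cons]

theorem smul_sub_eq_iff {σ : Type*} {A B Y : MvPowerSeries σ ℂ} :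
    (1 / (2 * Complex.I)) • (A - B) = Y ↔ A - B = C (2 * Complex.I) * Y := by
  have h2 : (2 * Complex.I) ≠ 0 := by simp
  rw [one_div, inv_smul_eq_iff₀ h2, smul_eq_C_mul]

theorem constantCoeff_half_smul {σ : Type*} {A B : MvPowerSeries σ ℂ}
    (hA : constantCoeff A = 0) (hB : constantCoeff B = 0) :
    constantCoeff ((1 / 2 : ℂ) • (A + B)) = 0 := by
  rw [smul_eq_C_mul]
  simp [hA, hB]

/-- The series `A` solves `(A - t)/(2i) = h(x, y, (A + t)/2)`. -/
def IsGraphValue {σ : Type*} (h : Series₃) (x y t A : MvPowerSeries σ ℂ) : Prop :=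
  A - t = C (2 * Complex.I) * subst ![x, y, (1 / 2 : ℂ) • (A + t)] h

/-- In the difference of two solutions every term has a factor y, which has no constant term; so the
order of A - B can be raised by one indefinitely. -/
theorem IsGraphValue.unique {σ : Type*} (hn : IsNormalForm p c g h)
    {x y t A B : MvPowerSeries σ ℂ} (hx : constantCoeff x = 0)
    (hy : constantCoeff y = 0) (ht : constantCoeff t = 0) (hA0 : constantCoeff A = 0)
    (hB0 : constantCoeff B = 0) (hA : IsGraphValue h x y t A) (hB : IsGraphValue h x y t B) :
    A = B := by
  have hUA := constantCoeff_half_smul hA0 ht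
  have hUB := constantCoeff_half_smul hB0 ht
  rw [IsGraphValue, hn.subst_eq hx hy hUA] at hA
  rw [IsGraphValue, hn.subst_eq hx hy hUB] at hB
  set U := (1 / 2 : ℂ) • (A + t) with hU
  set V := (1 / 2 : ℂ) • (B + t) with hV
  have hUV : U - V = C (1 / 2) * (A - B) := by
    rw [hU, hV, smul_eq_C_mul, smul_eq_C_mul]; ring
  rw [← sub_eq_zero]
  refine eq_zero_of_forall_mem_belowDegree fun n => ?_
  induction n with
  | zero => exact fun e he => absurd (show e.degree < 0 from he) (Nat.not_lt_zero _)
  | succ n ih =>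
    have h1 : U - V ∈ vanishingIdeal (belowDegree σ n) := by
      rw [hUV]; exact Ideal.mul_mem_left _ _ ih
    have h2 : U ^ (p + 1) - V ^ (p + 1) ∈ vanishingIdeal (belowDegree σ n) :=
      Ideal.mem_of_dvd _ (sub_dvd_pow_sub_pow _ _ _) h1
    have h3 : subst ![x, y, U] g - subst ![x, y, V] g ∈ vanishingIdeal (belowDegree σ n) := by
      refine subst_sub_subst_mem _ (vec3_constantCoeff hx hy hUA) (vec3_constantCoeff hx hy hUB)
        (fun i => ?_) g
      fin_cases i
      · simp
      · simp
      · exact h1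
    have h4 : A - B = C (2 * Complex.I) * (C c * x * y + y ^ 2 * subst ![x, y, U] g) *
        (U ^ (p + 1) - V ^ (p + 1)) +
        C (2 * Complex.I) * V ^ (p + 1) * y ^ 2 * (subst ![x, y, U] g - subst ![x, y, V] g) := by
      linear_combination hA - hB
    rw [h4, add_comm n 1]
    refine Ideal.add_mem _ (mul_mem_belowDegree (mem_belowDegree_one.2 ?_) h2)
      (mul_mem_belowDegree (mem_belowDegree_one.2 ?_) h3)
    · simp [hx, hy]
    · simp [hy]

variable {Θ S : Series₃}

theorem constantCoeff_X_eq {σ : Type*} (i : σ) : constantCoeff (X i : MvPowerSeries σ ℂ) = 0 :=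
  constantCoeff_X i

/-- `Θ ≡ τ + 2 i c τᵐ z χ` modulo `χ²`. -/
theorem exists_eq_graph (hn : IsNormalForm p c g h) (hΘ : IsComplexDefiningFunction h Θ) :
    ∃ t, Θ = X 2 + C (2 * Complex.I * c) * X 2 ^ (p + 1) * X 0 * X 1 + X 1 ^ 2 * t := by
  obtain ⟨h0, hΘ⟩ := hΘ
  have hU := constantCoeff_half_smul h0 (constantCoeff_X_eq (2 : Fin 3))
  rw [smul_sub_eq_iff, hn.subst_eq (constantCoeff_X_eq 0) (constantCoeff_X_eq 1) hU] at hΘ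
  set U := (1 / 2 : ℂ) • (Θ + X 2) with hUdef
  rw [smul_eq_C_mul] at hUdef
  set r := subst ![X 0, X 1, U] g
  have h1 : X 1 ∣ Θ - X 2 := by
    rw [hΘ]
    exact ⟨C (2 * Complex.I) * (U ^ (p + 1) * (C c * X 0 + X 1 * r)), by ring⟩
  have h2 : X 1 ∣ U - X 2 := by
    obtain ⟨s, hs⟩ := h1
    refine ⟨C (1 / 2) * s, ?_⟩
    have hh : (C (1 / 2) : Series₃) * 2 = 1 := by
      rw [← map_ofNat (C (σ := Fin 3) (R := ℂ)) 2, ← map_mul]; norm_num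
    rw [hUdef]
    linear_combination C (1 / 2) * hs + X 2 * hh
  obtain ⟨s, hs⟩ := h2.trans (sub_dvd_pow_sub_pow U (X 2) (p + 1))
  refine ⟨C (2 * Complex.I) * (s * C c * X 0 + U ^ (p + 1) * r), ?_⟩
  rw [map_mul (C (σ := Fin 3) (R := ℂ))]
  linear_combination hΘ + C (2 * Complex.I) * C c * X 0 * X 1 * hs

/-- Θ_z ≡ 2ic τᵐ χ modulo χ² and Θᵐ ≡ τᵐ modulo χ, so dividing by Θᵐ leaves 2ic χ. The slope thus
has the nonzero linear term needed to use it as a coordinate in place of χ. -/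
theorem exists_slope_eq (hn : IsNormalForm p c g h) (hΘ : IsComplexDefiningFunction h Θ)
    (hS : pderiv ℂ 0 Θ = Θ ^ (p + 1) * S) :
    ∃ r, S = C (2 * Complex.I * c) * X 1 + X 1 ^ 2 * r := by
  obtain ⟨t, ht⟩ := exists_eq_graph hn hΘ
  have h1 : X 1 ∣ Θ - X 2 := ⟨C (2 * Complex.I * c) * X 2 ^ (p + 1) * X 0 + X 1 * t, by
    linear_combination ht⟩
  have h2 := h1.trans (sub_dvd_pow_sub_pow Θ (X 2) (p + 1))
  have h3 : pderiv ℂ 0 Θ =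
      C (2 * Complex.I * c) * X 2 ^ (p + 1) * X 1 + X 1 ^ 2 * pderiv ℂ 0 t := by
    rw [ht]
    simp only [map_add, Derivation.leibniz, Derivation.leibniz_pow, pderiv_C, pderiv_X_self,
      pderiv_X_of_ne (show (2 : Fin 3) ≠ 0 by decide),
      pderiv_X_of_ne (show (1 : Fin 3) ≠ 0 by decide), smul_eq_mul]
    ring
  rw [h3] at hS
  have hp : ∃ j k, j ≠ (1 : Fin 3) ∧ X 1 ∣ Θ ^ (p + 1) - (X j ^ k : Series₃) :=
    ⟨2, p + 1, by decide, h2⟩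
  obtain ⟨s, hs⟩ : X 1 ∣ S := by
    refine X_dvd_of_X_dvd_mul hp ?_
    rw [← hS]
    exact ⟨C (2 * Complex.I * c) * X 2 ^ (p + 1) + X 1 * pderiv ℂ 0 t, by ring⟩
  obtain ⟨r, hr⟩ : X 1 ∣ s - C (2 * Complex.I * c) := by
    refine X_dvd_of_X_dvd_mul hp ?_
    obtain ⟨q, hq⟩ := h2
    refine ⟨pderiv ℂ 0 t - q * C (2 * Complex.I * c), mul_left_cancel₀ (X_ne_zero 1) ?_⟩
    rw [hs] at hS
    linear_combination -hS - X 1 * C (2 * Complex.I * c) * hq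
  exact ⟨r, by rw [hs]; linear_combination X 1 * hr⟩

/-- The Segre varieties have the form `w = τ ϑ` with `ϑ(0) = 1`. -/
theorem exists_eq_X_two_mul (hn : IsNormalForm p c g h) (hΘ : IsComplexDefiningFunction h Θ) :
    ∃ ϑ, Θ = X 2 * ϑ ∧ constantCoeff ϑ = 1 := by
  obtain ⟨t, ht⟩ := exists_eq_graph hn hΘ
  obtain ⟨h0, hΘ⟩ := hΘ
  have hU := constantCoeff_half_smul h0 (constantCoeff_X_eq (2 : Fin 3))
  rw [smul_sub_eq_iff, hn.subst_eq (constantCoeff_X_eq 0) (constantCoeff_X_eq 1) hU] at hΘ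
  set U := (1 / 2 : ℂ) • (Θ + X 2) with hUdef
  rw [smul_eq_C_mul] at hUdef
  set r := subst ![X 0, X 1, U] g
  have h1 : X 2 ∣ U - C (1 / 2) * Θ := ⟨C (1 / 2), by rw [hUdef]; ring⟩
  obtain ⟨s, hs⟩ := h1.trans (sub_dvd_pow_sub_pow U (C (1 / 2) * Θ) (p + 1))
  -- Modulo τ one has U = Θ/2, so the graph equation becomes Θ times a unit ≡ 0.
  have h2 : X 2 ^ 1 ∣ Θ := by
    refine X_pow_dvd_of_X_pow_dvd_mul_unit (A := 1 - C (2 * Complex.I) * C (1 / 2) ^ (p + 1) *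
      Θ ^ p * (C c * X 0 * X 1 + X 1 ^ 2 * r)) (by simp) ?_
    refine ⟨1 + C (2 * Complex.I) * s * (C c * X 0 * X 1 + X 1 ^ 2 * r), ?_⟩
    rw [mul_pow] at hs
    linear_combination hΘ + C (2 * Complex.I) * (C c * X 0 * X 1 + X 1 ^ 2 * r) * hs
  rw [pow_one] at h2
  obtain ⟨ϑ, hϑ⟩ := h2
  refine ⟨ϑ, hϑ, ?_⟩
  have h3 := congrArg (coeff (0 + Finsupp.single (2 : Fin 3) 1)) (hϑ.symm.trans ht)
  have h4 := coeff_add_single_X_pow_mul 2 1 0 ϑ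
  rw [pow_one] at h4
  rw [h4, zero_add, coeff_zero_eq_constantCoeff_apply] at h3
  rw [h3, map_add, map_add, coeff_index_single_self_X, coeff_single_eq, coeff_single_eq]
  simp [Derivation.leibniz, pow_two]

end Admissible

/-! ### Action of maps on the complexified hypersurface. -/

section GraphMaps

variable {σ τ : Type*}

theorem subst_vec2 [Fintype σ] {b : σ → MvPowerSeries τ ℂ} (hb : ∀ i, constantCoeff (b i) = 0)
    {x y : MvPowerSeries σ ℂ} (hx : constantCoeff x = 0) (hy : constantCoeff y = 0)
    (f : MvPowerSeries (Fin 2) ℂ) :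
    subst b (subst ![x, y] f) = subst ![subst b x, subst b y] f := by
  rw [subst_subst (vec2_constantCoeff hx hy) hb]
  congr 1
  funext i
  fin_cases i <;> rfl

theorem subst_vec3 [Fintype σ] {b : σ → MvPowerSeries τ ℂ} (hb : ∀ i, constantCoeff (b i) = 0)
    {x y z : MvPowerSeries σ ℂ} (hx : constantCoeff x = 0) (hy : constantCoeff y = 0)
    (hz : constantCoeff z = 0) (f : Series₃) :
    subst b (subst ![x, y, z] f) = subst ![subst b x, subst b y, subst b z] f := by
  rw [subst_subst (vec3_constantCoeff hx hy hz) hb]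
  congr 1
  funext i
  fin_cases i <;> rfl

variable {h h' : Series₃} {x y t A : MvPowerSeries σ ℂ}

theorem subst_graphSeries {ψ : Fin 2 ⊕ Fin 2 → MvPowerSeries σ ℂ}
    (hψ : ∀ i, constantCoeff (ψ i) = 0) (h : Series₃) :
    subst ψ (graphSeries h) = (1 / (2 * Complex.I)) • (ψ (Sum.inl 1) - ψ (Sum.inr 1)) -
      subst ![ψ (Sum.inl 0), ψ (Sum.inr 0),
        (1 / 2 : ℂ) • (ψ (Sum.inl 1) + ψ (Sum.inr 1))] h := by
  have hs := hasSubst_of_zero hψ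
  rw [graphSeries, ← coe_substAlgHom hs, map_sub, map_smul, map_sub, coe_substAlgHom,
    subst_vec3 hψ (constantCoeff_X_eq _) (constantCoeff_X_eq _)
      (constantCoeff_half_smul (constantCoeff_X_eq _) (constantCoeff_X_eq _)), subst_smul hs,
    subst_add hs]
  simp only [subst_X hs]

theorem elim_constantCoeff (hx : constantCoeff x = 0) (hy : constantCoeff y = 0)
    (ht : constantCoeff t = 0) (hA : constantCoeff A = 0) (i : Fin 2 ⊕ Fin 2) :
    constantCoeff ((Sum.elim ![x, A] ![y, t] : Fin 2 ⊕ Fin 2 → MvPowerSeries σ ℂ) i) = 0 := by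
  rcases i with i | i
  · exact vec2_constantCoeff hx hA i
  · exact vec2_constantCoeff hy ht i

theorem isGraphValue_iff (hx : constantCoeff x = 0) (hy : constantCoeff y = 0)
    (ht : constantCoeff t = 0) (hA : constantCoeff A = 0) :
    IsGraphValue h x y t A ↔ subst (Sum.elim ![x, A] ![y, t]) (graphSeries h) = 0 := by
  rw [subst_graphSeries (elim_constantCoeff hx hy ht hA), sub_eq_zero, smul_sub_eq_iff]
  rfl

theorem IsGraphValue.subst [Fintype σ] {b : σ → MvPowerSeries τ ℂ}
    (hb : ∀ i, constantCoeff (b i) = 0)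
    (hx : constantCoeff x = 0) (hy : constantCoeff y = 0)
    (ht : constantCoeff t = 0) (hA : constantCoeff A = 0) (hg : IsGraphValue h x y t A) :
    IsGraphValue h (MvPowerSeries.subst b x) (MvPowerSeries.subst b y) (MvPowerSeries.subst b t)
      (MvPowerSeries.subst b A) := by
  have hs := hasSubst_of_zero hb
  have h1 := congrArg (MvPowerSeries.subst b) hg
  rw [subst_mul hs, subst_vec3 hb hx hy (constantCoeff_half_smul hA ht), subst_smul hs,
    subst_add hs, subst_C, ← coe_substAlgHom hs, map_sub, coe_substAlgHom] at h1
  exact h1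

/-- A map of hypersurfaces acts on the points of the complexified hypersurface. -/
theorem FormalMap.MapsInto.isGraphValue {H : FormalMap} (hH0 : ∀ i, constantCoeff (H i) = 0)
    (hH : H.MapsInto (graphSeries h) (graphSeries h'))
    (hx : constantCoeff x = 0) (hy : constantCoeff y = 0)
    (ht : constantCoeff t = 0) (hA : constantCoeff A = 0) (hg : IsGraphValue h x y t A) :
    IsGraphValue h' (MvPowerSeries.subst ![x, A] (H 0))
      (MvPowerSeries.subst ![y, t] (conjSeries (H 0)))
      (MvPowerSeries.subst ![y, t] (conjSeries (H 1))) (MvPowerSeries.subst ![x, A] (H 1)) := by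
  have hψ := elim_constantCoeff hx hy ht hA
  have hl := vec2_constantCoeff hx hA
  have hr := vec2_constantCoeff hy ht
  have hc : ∀ i, constantCoeff (conjSeries (H i)) = 0 := fun i => by
    rw [constantCoeff_conjSeries, hH0, map_zero]
  rw [isGraphValue_iff hx hy ht hA] at hg
  rw [isGraphValue_iff (by rw [constantCoeff_subst_of_zero hl, hH0])
    (by rw [constantCoeff_subst_of_zero hr, hc]) (by rw [constantCoeff_subst_of_zero hr, hc])
    (by rw [constantCoeff_subst_of_zero hl, hH0])]
  obtain ⟨q, hq⟩ := hH
  have h1 := congrArg (MvPowerSeries.subst (Sum.elim ![x, A] ![y, t])) hq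
  rw [subst_mul (hasSubst_of_zero hψ), hg, zero_mul,
    subst_subst (FormalMap.constantCoeff_complexify hH0) hψ] at h1
  rw [← h1]
  congr 1
  funext i
  rcases i with i | i
  · rw [FormalMap.complexify_inl, subst_rename _ hψ]
    fin_cases i <;> rfl
  · rw [FormalMap.complexify_inr, subst_rename _ hψ]
    fin_cases i <;> rfl

theorem X_pow_dvd_subst_of_mem_belowDegree [Fintype σ] {j : τ} {b : σ → MvPowerSeries τ ℂ}
    (hb : ∀ i, constantCoeff (b i) = 0) (hd : ∀ i, X j ∣ b i) (n : ℕ) (f : MvPowerSeries σ ℂ)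
    (hf : f ∈ vanishingIdeal (belowDegree σ n)) : X j ^ n ∣ MvPowerSeries.subst b f := by
  induction n generalizing f with
  | zero => simp
  | succ n ih =>
    have h0 : constantCoeff f = 0 := by
      have := hf 0 (show Finsupp.degree 0 < n + 1 by simp)
      rwa [coeff_zero_eq_constantCoeff_apply] at this
    rw [subst_eulerPart hb, h0, map_zero, zero_add]
    refine Finset.dvd_sum fun i _ => ?_
    rw [pow_succ']
    exact mul_dvd_mul (hd i) (ih _ (eulerPart_mem_belowDegree hf i))

theorem conjSeries_mem_belowDegree {σ : Type} {n : ℕ} {f : MvPowerSeries σ ℂ}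
    (hf : f ∈ vanishingIdeal (belowDegree σ n)) :
    conjSeries f ∈ vanishingIdeal (belowDegree σ n) := by
  intro e he
  rw [conjSeries, coeff_map, hf e he, map_zero]

theorem conjSeries_sub_X {σ : Type} (f : MvPowerSeries σ ℂ) (i : σ) :
    conjSeries (f - X i) = conjSeries f - X i := by
  rw [conjSeries, map_sub, map_X]; rfl

theorem subst_sub_X [Fintype σ] {b : σ → MvPowerSeries τ ℂ} (hb : ∀ i, constantCoeff (b i) = 0)
    (f : MvPowerSeries σ ℂ) (i : σ) :
    MvPowerSeries.subst b (f - X i) = MvPowerSeries.subst b f - b i := by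
  have hs := hasSubst_of_zero hb
  rw [← coe_substAlgHom hs, map_sub, coe_substAlgHom, subst_X hs]

end GraphMaps

/-! ### From the jet at the origin to initial conditions along w = 0. -/

section TangentMaps

variable {p : ℕ} {c : ℂ} {g h Θ : Series₃} {H : FormalMap}

theorem pow_dvd_subst_sub {n : ℕ} {f : MvPowerSeries (Fin 2) ℂ} {x y : Series₃}
    (hx : constantCoeff x = 0) (hy : constantCoeff y = 0)
    (hd : (X 1 : Series₃) ^ n ∣ subst ![X 0, X 1] f - X 1) : y ^ n ∣ subst ![x, y] f - y := by
  have hb := vec3_constantCoeff hx hy (map_zero (constantCoeff (σ := Fin 3) (R := ℂ)))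
  have hs := hasSubst_of_zero hb
  obtain ⟨q, hq⟩ := hd
  have h1 := congrArg (subst ![x, y, 0]) hq
  rw [subst_sub_X hb, subst_vec2 hb (constantCoeff_X_eq _) (constantCoeff_X_eq _), subst_mul hs,
    subst_pow hs, subst_X hs, subst_X hs] at h1
  exact ⟨_, h1⟩

theorem pow_dvd_subst_conj_sub {n : ℕ} {f : MvPowerSeries (Fin 2) ℂ}
    (hd : (X 1 : Series₃) ^ n ∣ subst ![X 0, X 1] f - X 1) :
    (X 1 : Series₃) ^ n ∣ subst ![X 0, X 1] (conjSeries f) - X 1 := by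
  obtain ⟨q, hq⟩ := hd
  have h1 := congrArg conjSeries hq
  rw [conjSeries_sub_X,
    conjSeries_subst (vec2_constantCoeff (constantCoeff_X_eq _) (constantCoeff_X_eq _))] at h1
  refine ⟨conjSeries q, ?_⟩
  have h2 : (fun i => conjSeries ((![X 0, X 1] : Fin 2 → Series₃) i)) = ![X 0, X 1] := by
    funext i
    fin_cases i <;> exact map_X _ _
  rw [h2] at h1
  rw [h1, conjSeries, map_mul, map_pow, map_X]
  rfl

/-- The transversal component of a map that is tangent to the identity. -/
theorem X_pow_dvd_second_sub (hn : IsNormalForm p c g h) (hH0 : ∀ i, constantCoeff (H i) = 0)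
    (hH : H.MapsInto (graphSeries h) (graphSeries h))
    (hj : ∀ i, H i - X i ∈ vanishingIdeal (belowDegree (Fin 2) (p + 2))) :
    (X 1 : Series₃) ^ (p + 2) ∣ subst ![X 0, X 1] (H 1) - X 1 := by
  have hX := constantCoeff_X_eq (σ := Fin 3)
  have h00 := map_zero (constantCoeff (σ := Fin 3) (R := ℂ))
  have hl := vec2_constantCoeff (hX 0) (hX 1)
  have hr := vec2_constantCoeff h00 (hX 1)
  have hc : ∀ i, constantCoeff (conjSeries (H i)) = 0 := fun i => by
    rw [constantCoeff_conjSeries, hH0, map_zero]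
  have hd : ∀ i, (X 1 : Series₃) ∣ (![0, X 1] : Fin 2 → Series₃) i := by
    intro i; fin_cases i <;> simp
  -- The Segre variety with χ = 0 is the line w = τ; here `X 1` plays the role of τ.
  have hg0 : IsGraphValue h (X 0 : Series₃) 0 (X 1) (X 1) := by
    rw [IsGraphValue, hn.subst_eq (hX 0) h00 (constantCoeff_half_smul (hX 1) (hX 1))]
    ring
  have h1 := hH.isGraphValue hH0 (hX 0) h00 (hX 1) (hX 1) hg0
  have hF0 : constantCoeff (subst ![X 0, X 1] (H 0) : Series₃) = 0 := by
    rw [constantCoeff_subst_of_zero hl, hH0]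
  have hG0 : constantCoeff (subst ![X 0, X 1] (H 1) : Series₃) = 0 := by
    rw [constantCoeff_subst_of_zero hl, hH0]
  have hf0 : constantCoeff (subst ![0, X 1] (conjSeries (H 0)) : Series₃) = 0 := by
    rw [constantCoeff_subst_of_zero hr, hc]
  have hg0 : constantCoeff (subst ![0, X 1] (conjSeries (H 1)) : Series₃) = 0 := by
    rw [constantCoeff_subst_of_zero hr, hc]
  have hf1 : (X 1 : Series₃) ∣ subst ![0, X 1] (conjSeries (H 0)) := by
    have := X_pow_dvd_subst_of_mem_belowDegree hr hd 1 _ (mem_belowDegree_one.2 (hc 0))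
    rwa [pow_one] at this
  have hg1 : (X 1 : Series₃) ∣ subst ![0, X 1] (conjSeries (H 1)) := by
    have := X_pow_dvd_subst_of_mem_belowDegree hr hd 1 _ (mem_belowDegree_one.2 (hc 1))
    rwa [pow_one] at this
  have hg2 : (X 1 : Series₃) ^ (p + 2) ∣ subst ![0, X 1] (conjSeries (H 1)) - X 1 := by
    have := X_pow_dvd_subst_of_mem_belowDegree hr hd (p + 2) _ (conjSeries_mem_belowDegree (hj 1))
    rwa [conjSeries_sub_X, subst_sub_X hr] at this
  rw [IsGraphValue, hn.subst_eq hF0 hf0 (constantCoeff_half_smul hG0 hg0)] at h1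
  set F := (subst ![X 0, X 1] (H 0) : Series₃)
  set G := (subst ![X 0, X 1] (H 1) : Series₃)
  set f := (subst ![0, X 1] (conjSeries (H 0)) : Series₃)
  set e := (subst ![0, X 1] (conjSeries (H 1)) : Series₃)
  set U := (1 / 2 : ℂ) • (G + e) with hU
  set r := subst ![F, f, U] g
  have h2 : X 1 ∣ G - e := by
    rw [h1]
    exact hf1.trans ⟨C (2 * Complex.I) * (U ^ (p + 1) * (C c * F + f * r)), by ring⟩
  have h3 : X 1 ∣ U := by
    rw [hU, smul_eq_C_mul, show G + e = (G - e) + (e + e) by ring]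
    exact ((h2.add (hg1.add hg1)).mul_left _)
  -- Uᵖ⁺¹ contributes p + 1 factors τ, and the conjugate first component at (0, τ) contributes one
  -- more.
  have h4 : X 1 ^ (p + 2) ∣ G - e := by
    rw [h1, show C (2 * Complex.I) * (U ^ (p + 1) * (C c * F * f + f ^ 2 * r)) =
      U ^ (p + 1) * f * (C (2 * Complex.I) * (C c * F + f * r)) by ring]
    exact (mul_dvd_mul (pow_dvd_pow_of_dvd h3 _) hf1).mul_right _
  rw [show G - X 1 = (G - e) + (e - X 1) by ring]
  exact h4.add hg2

/-- Since the transversal component is the identity up to order m + 1, dividing the graph equations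
by τᵐ and setting τ = 0 gives c F(z, 0) F̄(χ, 0) + O(χ²) = c zχ + O(χ²). The jet gives F̄(χ, 0) = χ
+ O(χ²), and the coefficient of χ yields F(z, 0) = z. -/
theorem X_dvd_first_sub (hc0 : c ≠ 0) (hn : IsNormalForm p c g h)
    (hΘ : IsComplexDefiningFunction h Θ) (hH0 : ∀ i, constantCoeff (H i) = 0)
    (hH : H.MapsInto (graphSeries h) (graphSeries h))
    (hj : ∀ i, H i - X i ∈ vanishingIdeal (belowDegree (Fin 2) (p + 2))) :
    (X 1 : Series₃) ∣ subst ![X 0, X 1] (H 0) - X 0 := by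
  have hX := constantCoeff_X_eq (σ := Fin 3)
  have h00 := map_zero (constantCoeff (σ := Fin 3) (R := ℂ))
  obtain ⟨ϑ, hϑ, hϑ0⟩ := exists_eq_X_two_mul hn hΘ
  have hG := X_pow_dvd_second_sub hn hH0 hH hj
  have hl := vec2_constantCoeff (hX 0) hΘ.1
  have hr := vec2_constantCoeff (hX 1) (hX 2)
  have hc : ∀ i, constantCoeff (conjSeries (H i)) = 0 := fun i => by
    rw [constantCoeff_conjSeries, hH0, map_zero]
  have hgΘ : IsGraphValue h (X 0) (X 1) (X 2) Θ := smul_sub_eq_iff.1 hΘ.2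
  have h1 := hH.isGraphValue hH0 (hX 0) (hX 1) (hX 2) hΘ.1 hgΘ
  have hF0 : constantCoeff (subst ![X 0, Θ] (H 0) : Series₃) = 0 := by
    rw [constantCoeff_subst_of_zero hl, hH0]
  have hG0 : constantCoeff (subst ![X 0, Θ] (H 1) : Series₃) = 0 := by
    rw [constantCoeff_subst_of_zero hl, hH0]
  have hf0 : constantCoeff (subst ![X 1, X 2] (conjSeries (H 0)) : Series₃) = 0 := by
    rw [constantCoeff_subst_of_zero hr, hc]
  have hg0 : constantCoeff (subst ![X 1, X 2] (conjSeries (H 1)) : Series₃) = 0 := by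
    rw [constantCoeff_subst_of_zero hr, hc]
  have hU0 := constantCoeff_half_smul hΘ.1 (hX 2)
  have hV0 := constantCoeff_half_smul hG0 hg0
  rw [IsGraphValue, hn.subst_eq hF0 hf0 hV0] at h1
  rw [IsGraphValue, hn.subst_eq (hX 0) (hX 1) hU0] at hgΘ
  have hW := pow_dvd_subst_sub (hX 0) hΘ.1 hG
  have hT := pow_dvd_subst_sub (hX 1) (hX 2) (pow_dvd_subst_conj_sub hG)
  replace hW : X 2 ^ (p + 2) ∣ subst ![X 0, Θ] (H 1) - Θ :=
    (pow_dvd_pow_of_dvd ⟨ϑ, hϑ⟩ _).trans hW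
  set U := (1 / 2 : ℂ) • (Θ + X 2) with hU
  set V := (1 / 2 : ℂ) • (subst ![X 0, Θ] (H 1) + subst ![X 1, X 2] (conjSeries (H 1)) : Series₃)
    with hV
  -- the two second factors agree for `τ = 0`
  have key : X 2 ∣ (C c * subst ![X 0, Θ] (H 0) * subst ![X 1, X 2] (conjSeries (H 0)) +
      subst ![X 1, X 2] (conjSeries (H 0)) ^ 2 * subst
        ![subst ![X 0, Θ] (H 0), subst ![X 1, X 2] (conjSeries (H 0)), V] g) -
      (C c * X 0 * X 1 + X 1 ^ 2 * subst ![X 0, X 1, U] g : Series₃) := by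
    set κ := (C c * X 0 * X 1 + X 1 ^ 2 * subst ![X 0, X 1, U] g : Series₃)
    set κ' := (C c * subst ![X 0, Θ] (H 0) * subst ![X 1, X 2] (conjSeries (H 0)) +
      subst ![X 1, X 2] (conjSeries (H 0)) ^ 2 * subst
        ![subst ![X 0, Θ] (H 0), subst ![X 1, X 2] (conjSeries (H 0)), V] g : Series₃)
    set W := (subst ![X 0, Θ] (H 1) : Series₃)
    set T := (subst ![X 1, X 2] (conjSeries (H 1)) : Series₃)
    obtain ⟨w, hw⟩ := hW
    obtain ⟨t, ht⟩ := hT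
    rw [smul_eq_C_mul] at hU hV
    set u := (C (1 / 2) * (ϑ + 1) : Series₃) with hu
    have hUu : U = X 2 * u := by rw [hU, hϑ]; ring
    have hVu : V = X 2 * (u + X 2 * (C (1 / 2) * X 2 ^ p * (w + t))) := by
      rw [hV, hu]
      linear_combination C (1 / 2) * (hw + ht + hϑ)
    obtain ⟨s, hs⟩ : X 2 ∣ (u + X 2 * (C (1 / 2) * X 2 ^ p * (w + t))) ^ (p + 1) - u ^ (p + 1) :=
      Dvd.dvd.trans ⟨C (1 / 2) * X 2 ^ p * (w + t), by ring⟩ (sub_dvd_pow_sub_pow _ _ _)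
    rw [hVu, mul_pow] at h1
    rw [hUu, mul_pow] at hgΘ
    -- The left sides of the two graph equations differ by τᵖ⁺²(w - t), so a factor τ survives after
    -- τᵖ⁺¹ is cancelled.
    have h2 : (C (2 * Complex.I) : Series₃) * u ^ (p + 1) * (κ' - κ) =
        X 2 * (w - t - C (2 * Complex.I) * s * κ') := by
      refine mul_left_cancel₀ (pow_ne_zero (p + 1) (X_ne_zero 2)) ?_
      linear_combination hgΘ - h1 + hw - ht -
        C (2 * Complex.I) * X 2 ^ (p + 1) * κ' * hs
    have h3 := X_pow_dvd_of_X_pow_dvd_mul_unit (i := (2 : Fin 3)) (n := 1)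
      (A := C (2 * Complex.I) * u ^ (p + 1)) (B := κ' - κ) (by simp [hu, hϑ0])
      (by rw [h2, pow_one]; exact Dvd.intro _ rfl)
    rwa [pow_one] at h3
  obtain ⟨q, hq⟩ := key
  have hb := vec3_constantCoeff (hX 0) (hX 1) h00
  have hs := hasSubst_of_zero hb
  have hΘb : subst ![X 0, X 1, 0] Θ = (0 : Series₃) := by
    rw [hϑ, subst_mul hs, subst_X hs]; simp
  have h4 := congrArg (subst (![X 0, X 1, 0] : Fin 3 → Series₃)) hq
  rw [← coe_substAlgHom hs] at h4
  simp only [map_sub, map_add, map_mul, map_pow, coe_substAlgHom, subst_C,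
    subst_vec2 hb (hX 0) hΘ.1, subst_vec2 hb (hX 1) (hX 2), subst_X hs, hΘb,
    Matrix.cons_val_zero, Matrix.cons_val_one, Matrix.cons_val_two, Matrix.tail_cons,
    Matrix.head_cons, zero_mul] at h4
  have hr0 := vec2_constantCoeff (hX 1) h00
  obtain ⟨s, hs1⟩ : (X 1 : Series₃) ^ 2 ∣ subst ![X 1, 0] (conjSeries (H 0)) - X 1 := by
    have := X_pow_dvd_subst_of_mem_belowDegree (j := (1 : Fin 3)) hr0
      (fun i => by fin_cases i <;> simp) (p + 2) _ (conjSeries_mem_belowDegree (hj 0))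
    rw [conjSeries_sub_X, subst_sub_X hr0] at this
    exact (pow_dvd_pow _ (by omega)).trans this
  have h5 : X 1 ∣ (subst ![X 0, 0] (H 0) - X 0 : Series₃) := by
    set F := (subst ![X 0, 0] (H 0) : Series₃)
    set f := (subst ![X 1, 0] (conjSeries (H 0)) : Series₃)
    have h6 : f = X 1 * (1 + X 1 * s) := by linear_combination hs1
    obtain ⟨r, r', h4⟩ : ∃ r r', C c * F * f + f ^ 2 * r' - (C c * X 0 * X 1 + X 1 ^ 2 * r) = 0 :=
      ⟨_, _, h4⟩
    rw [h6] at h4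
    refine (IsUnit.dvd_mul_left (isUnit_of_constantCoeff_ne_zero (A := (C c : Series₃))
      (by simpa using hc0))).1 ⟨r - (1 + X 1 * s) ^ 2 * r' - C c * F * s, ?_⟩
    refine mul_left_cancel₀ (X_ne_zero 1) ?_
    linear_combination h4
  -- The difference is divisible by χ but does not contain χ; setting χ = 0 shows that it vanishes.
  have h7 : (subst ![X 0, 0] (H 0) : Series₃) = X 0 := by
    have hb' := vec3_constantCoeff (hX 0) h00 h00
    have hs' := hasSubst_of_zero hb'
    obtain ⟨r, hr1⟩ := h5
    have h8 := congrArg (subst (![X 0, 0, 0] : Fin 3 → Series₃)) hr1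
    rw [subst_sub_X hb', subst_vec2 hb' (hX 0) h00, subst_mul hs', subst_X hs', subst_X hs',
      ← coe_substAlgHom hs', map_zero] at h8
    simpa [sub_eq_zero] using h8
  have h9 := X_pow_dvd_subst_sub_subst (j := (1 : Fin 3)) (n := 1)
    (vec2_constantCoeff (hX 0) (hX 1)) (vec2_constantCoeff (hX 0) h00)
    (fun i => by fin_cases i <;> simp) (H 0)
  rwa [h7, pow_one] at h9

end TangentMaps

/-! ### Symmetries of the hypersurface as symmetries of the ODE. -/

section Transport

variable {p : ℕ} {c : ℂ} {g h Θ S Φ : Series₃} {H : FormalMap}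

theorem ne_zero_of_eq_X_two_mul (hn : IsNormalForm p c g h)
    (hΘ : IsComplexDefiningFunction h Θ) : Θ ≠ 0 := by
  obtain ⟨ϑ, rfl, hϑ0⟩ := exists_eq_X_two_mul hn hΘ
  refine mul_ne_zero (X_ne_zero 2) ?_
  rintro rfl
  simp at hϑ0

/-- Differentiating Θ_z = Θᵐ S and cancelling Θᵐ gives the evolution of the slope; this is the
ζ-coefficient of the total derivative. -/
theorem pderiv_slope (hn : IsNormalForm p c g h) (hΘ : IsComplexDefiningFunction h Θ)
    (hS : pderiv ℂ 0 Θ = Θ ^ (p + 1) * S)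
    (hΦ : pderiv ℂ 0 (pderiv ℂ 0 Θ) = Θ ^ (p + 1) * subst ![X 0, Θ, S] Φ) :
    pderiv ℂ 0 S = subst ![X 0, Θ, S] Φ - ((p : Series₃) + 1) * Θ ^ p * S ^ 2 := by
  refine mul_left_cancel₀ (pow_ne_zero (p + 1) (ne_zero_of_eq_X_two_mul hn hΘ)) ?_
  rw [hS, Derivation.leibniz, Derivation.leibniz_pow, hS] at hΦ
  simp only [smul_eq_mul, Nat.add_sub_cancel, nsmul_eq_mul, Nat.cast_add, Nat.cast_one] at hΦ
  linear_combination hΦ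

/-- The total derivative is the derivative along the solutions of the equation. -/
theorem pderiv_subst_jet (hn : IsNormalForm p c g h) (hΘ : IsComplexDefiningFunction h Θ)
    (hS0 : constantCoeff S = 0) (hS : pderiv ℂ 0 Θ = Θ ^ (p + 1) * S)
    (hΦ : pderiv ℂ 0 (pderiv ℂ 0 Θ) = Θ ^ (p + 1) * subst ![X 0, Θ, S] Φ) (P : Series₃) :
    pderiv ℂ 0 (subst ![X 0, Θ, S] P) = subst ![X 0, Θ, S] (totalDerivative p Φ P) := by
  have hJ := vec3_constantCoeff (constantCoeff_X_eq (0 : Fin 3)) hΘ.1 hS0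
  have hs := hasSubst_of_zero hJ
  rw [pderiv_subst hJ, Fin.sum_univ_three, totalDerivative_apply, ← coe_substAlgHom hs]
  simp only [map_add, map_mul, map_sub, map_pow, map_natCast, map_one]
  simp only [coe_substAlgHom, subst_X hs, Matrix.cons_val_zero, Matrix.cons_val_one,
    Matrix.cons_val_two, Matrix.tail_cons, Matrix.head_cons, pderiv_X_self, hS,
    pderiv_slope hn hΘ hS hΦ]
  ring

/-- The coordinates `(z, χ, τ)` on the space of one-jets of the Segre varieties. -/
theorem exists_jet_inverse (hc0 : c ≠ 0) (hn : IsNormalForm p c g h)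
    (hΘ : IsComplexDefiningFunction h Θ)
    (hS0 : constantCoeff S = 0) (hS : pderiv ℂ 0 Θ = Θ ^ (p + 1) * S) :
    ∃ K : Fin 3 → Series₃, (∀ i, constantCoeff (K i) = 0) ∧
      (∀ i, subst ![X 0, Θ, S] (K i) = X i) ∧
      ∀ i, subst K ((![X 0, Θ, S] : Fin 3 → Series₃) i) = X i := by
  refine exists_inverse (vec3_constantCoeff (constantCoeff_X_eq 0) hΘ.1 hS0) ?_
  obtain ⟨t, ht⟩ := exists_eq_graph hn hΘ
  obtain ⟨r, hr⟩ := exists_slope_eq hn hΘ hS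
  have hl : linearPart (![X 0, Θ, S] : Fin 3 → Series₃) =
      !![1, 0, 0; 0, 0, 1; 0, 2 * Complex.I * c, 0] := by
    ext i j
    fin_cases i <;> fin_cases j <;>
      simp [linearPart, coeff_single_eq, ht, hr, Derivation.leibniz, Derivation.leibniz_pow,
        pow_succ]
  rw [hl, Matrix.det_fin_three]
  simp [hc0]

theorem pderiv_zero_subst_param (f : MvPowerSeries (Fin 2) ℂ) :
    pderiv ℂ 0 (subst ![X 1, X 2] f : Series₃) = 0 := by
  rw [pderiv_subst (vec2_constantCoeff (constantCoeff_X_eq 1) (constantCoeff_X_eq 2)),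
    Fin.sum_univ_two]
  simp [pderiv_X_of_ne (show (2 : Fin 3) ≠ 0 by decide),
      pderiv_X_of_ne (show (1 : Fin 3) ≠ 0 by decide)]

theorem coeff_subst_first_two (f : MvPowerSeries (Fin 2) ℂ) (n : Fin 3 →₀ ℕ)
    (hn : coeff n (subst ![X 0, X 1] f : Series₃) ≠ 0) : n 2 = 0 := by
  by_contra h2
  refine hn ?_
  have he : (![X 0, X 1] : Fin 2 → Series₃) = X ∘ Fin.castSucc := by
    funext i; fin_cases i <;> rfl
  rw [he, ← rename_eq_subst]
  refine coeff_rename_eq_zero _ _ ?_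
  rintro ⟨x, rfl⟩
  refine h2 (Finsupp.mapDomain_of_notMem_range _ _ ?_)
  rintro ⟨i, hi⟩
  fin_cases i <;> simp [Fin.ext_iff] at hi

/-- A self-map of an admissible nonresonant hypersurface that is tangent to the identity to order
`m` is the identity. -/
theorem eq_X_of_mapsInto_self (hc0 : c ≠ 0) (hn : IsNormalForm p c g h)
    (hass : IsAssociatedODE (p + 1) h Φ) (hres : IsNonResonantODE (p + 1) Φ)
    (hH0 : ∀ i, constantCoeff (H i) = 0)
    (hH : H.MapsInto (graphSeries h) (graphSeries h))
    (hj : ∀ i, H i - X i ∈ vanishingIdeal (belowDegree (Fin 2) (p + 2))) (i : Fin 2) :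
    H i = X i := by
  obtain ⟨hΦ2, Θ, S, hΘ, hS0, hS, hΦ⟩ := hass
  have hX := constantCoeff_X_eq (σ := Fin 3)
  obtain ⟨K, hK0, hJK, hKJ⟩ := exists_jet_inverse hc0 hn hΘ hS0 hS
  have hJ := vec3_constantCoeff (hX 0) hΘ.1 hS0
  have hJs := hasSubst_of_zero hJ
  have hinj : ∀ {A B : Series₃}, subst ![X 0, Θ, S] A = subst ![X 0, Θ, S] B → A = B := by
    intro A B hAB
    have := congrArg (subst (K : Fin 3 → Series₃)) hAB
    rwa [subst_subst hJ hK0, subst_subst hJ hK0, funext hKJ, subst_X_eq, subst_X_eq] at this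
  have hl := vec2_constantCoeff (hX 0) hΘ.1
  have hr := vec2_constantCoeff (hX 1) (hX 2)
  have h01 := vec2_constantCoeff (hX 0) (hX 1)
  have hc : ∀ i, constantCoeff (conjSeries (H i)) = 0 := fun i => by
    rw [constantCoeff_conjSeries, hH0, map_zero]
  have hgΘ : IsGraphValue h (X 0 : Series₃) (X 1) (X 2) Θ := smul_sub_eq_iff.1 hΘ.2
  have h1 := hH.isGraphValue hH0 (hX 0) (hX 1) (hX 2) hΘ.1 hgΘ
  have hF0 : constantCoeff (subst ![X 0, Θ] (H 0) : Series₃) = 0 := by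
    rw [constantCoeff_subst_of_zero hl, hH0]
  have hG0 : constantCoeff (subst ![X 0, Θ] (H 1) : Series₃) = 0 := by
    rw [constantCoeff_subst_of_zero hl, hH0]
  have hf0 : constantCoeff (subst ![X 1, X 2] (conjSeries (H 0)) : Series₃) = 0 := by
    rw [constantCoeff_subst_of_zero hr, hc]
  have hg0 : constantCoeff (subst ![X 1, X 2] (conjSeries (H 1)) : Series₃) = 0 := by
    rw [constantCoeff_subst_of_zero hr, hc]
  have hF : subst ![X 0, Θ, S] (subst ![X 0, X 1] (H 0) : Series₃) =
      (subst ![X 0, Θ] (H 0) : Series₃) := by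
    rw [subst_vec2 hJ (hX 0) (hX 1), subst_X hJs, subst_X hJs]; rfl
  have hG : subst ![X 0, Θ, S] (subst ![X 0, X 1] (H 1) : Series₃) =
      (subst ![X 0, Θ] (H 1) : Series₃) := by
    rw [subst_vec2 hJ (hX 0) (hX 1), subst_X hJs, subst_X hJs]; rfl
  have hdχ := pderiv_zero_subst_param (conjSeries (H 0))
  have hdτ := pderiv_zero_subst_param (conjSeries (H 1))
  set Z := (subst ![X 0, Θ] (H 0) : Series₃)
  set W := (subst ![X 0, Θ] (H 1) : Series₃)
  set χ := (subst ![X 1, X 2] (conjSeries (H 0)) : Series₃)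
  set τ := (subst ![X 1, X 2] (conjSeries (H 1)) : Series₃)
  have hA := vec3_constantCoeff hF0 hf0 hg0
  have hAs := hasSubst_of_zero hA
  -- The image of a Segre variety is the Segre variety whose parameters are the conjugate map at (χ,
  -- τ); both sides solve the same graph equation.
  have hW : subst ![Z, χ, τ] Θ = W := by
    have h2 := hgΘ.subst hA (hX 0) (hX 1) (hX 2) hΘ.1
    rw [subst_X hAs, subst_X hAs, subst_X hAs] at h2
    refine h2.unique hn hF0 hf0 hg0 ?_ hG0 h1
    rw [constantCoeff_subst_of_zero hA, hΘ.1]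
  have hchain : ∀ P : Series₃, pderiv ℂ 0 (subst ![Z, χ, τ] P) =
      subst ![Z, χ, τ] (pderiv ℂ 0 P) * pderiv ℂ 0 Z := by
    intro P
    rw [pderiv_subst hA, Fin.sum_univ_three]
    simp [hdχ, hdτ]
  set T := subst ![Z, χ, τ] S with hT
  have hT0 : constantCoeff T = 0 := by rw [hT, constantCoeff_subst_of_zero hA, hS0]
  -- T is the slope of the image variety; composing with K rewrites it as a series σ in the jet
  -- variables (z, w, ζ).
  have hσ : subst ![X 0, Θ, S] (subst K T) = T := by
    rw [subst_subst hK0 hJ, funext hJK, subst_X_eq]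
  have hσ0 : constantCoeff (subst K T) = 0 := by rw [constantCoeff_subst_of_zero hK0, hT0]
  have hdΘ : subst ![Z, χ, τ] (pderiv ℂ 0 Θ) = W ^ (p + 1) * T := by
    rw [hS, subst_mul hAs, subst_pow hAs, hW]
  have hdW : pderiv ℂ 0 W = W ^ (p + 1) * T * pderiv ℂ 0 Z := by
    rw [← hW, hchain, hdΘ, hW]
  have hddW : pderiv ℂ 0 (W ^ (p + 1) * T) =
      W ^ (p + 1) * subst ![Z, W, T] Φ * pderiv ℂ 0 Z := by
    rw [← hdΘ, hchain, hΦ, subst_mul hAs, subst_pow hAs, hW, subst_vec3 hA (hX 0) hΘ.1 hS0,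
      subst_X hAs, hW]
    rfl
  have hjet := pderiv_subst_jet hn hΘ hS0 hS hΦ
  have hF0' : constantCoeff (subst ![X 0, X 1] (H 0) : Series₃) = 0 := by
    rw [constantCoeff_subst_of_zero h01, hH0]
  have hG0' : constantCoeff (subst ![X 0, X 1] (H 1) : Series₃) = 0 := by
    rw [constantCoeff_subst_of_zero h01, hH0]
  have hfin := eq_X_of_symmetry p Φ (subst ![X 0, X 1] (H 0)) (subst ![X 0, X 1] (H 1))
    (subst K T) hΦ2 hres (coeff_subst_first_two _) (coeff_subst_first_two _)
    (X_dvd_first_sub hc0 hn hΘ hH0 hH hj) (X_pow_dvd_second_sub hn hH0 hH hj)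
    (hinj (by
      rw [← hjet, subst_mul hJs, subst_mul hJs, subst_pow hJs, ← hjet, hF, hG, hσ, hdW]))
    (hinj (by
      rw [← hjet, subst_mul hJs, subst_mul hJs, subst_mul hJs, subst_pow hJs, ← hjet, hF, hG, hσ,
        hddW, subst_vec3 hJ hF0' hG0' hσ0, hF, hG, hσ]))
  -- Setting ζ = 0 recovers the original map from its copy in three variables.
  have hback : ∀ f : MvPowerSeries (Fin 2) ℂ,
      subst (![X 0, X 1, 0] : Fin 3 → MvPowerSeries (Fin 2) ℂ) (subst ![X 0, X 1] f : Series₃) =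
        f := by
    intro f
    have hb := vec3_constantCoeff (constantCoeff_X_eq (0 : Fin 2)) (constantCoeff_X_eq 1)
      (map_zero constantCoeff)
    have hbs := hasSubst_of_zero hb
    rw [subst_vec2 hb (hX 0) (hX 1), subst_X hbs, subst_X hbs]
    conv_rhs => rw [← subst_X_eq f]
    congr 1
    funext i
    fin_cases i <;> rfl
  have hX01 : ∀ i : Fin 2, (subst ![X 0, X 1] (X i : MvPowerSeries (Fin 2) ℂ) : Series₃) =
      (![X 0, X 1] : Fin 2 → Series₃) i := fun i => subst_X (hasSubst_of_zero h01) i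
  rw [← hback (H i), ← hback (X i), hX01]
  congr 1
  fin_cases i
  · exact hfin.1
  · exact hfin.2

end Transport

/-! ### Reduction to self-maps in admissible coordinates. -/

section Reduction

theorem FormalMap.IsInvertible.exists_inverse {A : FormalMap} (hA : A.IsInvertible) :
    ∃ B : FormalMap, (∀ i, constantCoeff (B i) = 0) ∧ (A.comp B = fun i => X i) ∧
      (B.comp A = fun i => X i) := by
  obtain ⟨B, h0, h1, h2⟩ := InfiniteType.exists_inverse hA.1 hA.2
  exact ⟨B, h0, funext h2, funext h1⟩

theorem FormalMap.comp_assoc (A : FormalMap) {B E : FormalMap}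
    (hB : ∀ i, constantCoeff (B i) = 0) (hE : ∀ i, constantCoeff (E i) = 0) :
    (A.comp B).comp E = A.comp (B.comp E) := by
  funext i
  exact subst_subst hB hE (A i)

theorem FormalMap.comp_X (A : FormalMap) : A.comp (fun i => X i) = A := by
  funext i
  exact subst_X_eq (A i)

theorem FormalMap.X_comp {A : FormalMap} (hA : ∀ i, constantCoeff (A i) = 0) :
    FormalMap.comp (fun i => X i) A = A := by
  funext i
  exact subst_X (hasSubst_of_zero hA) i

theorem FormalMap.comp_sub_comp_mem {n : ℕ} (A : FormalMap) {B E : FormalMap}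
    (hB : ∀ i, constantCoeff (B i) = 0) (hE : ∀ i, constantCoeff (E i) = 0)
    (h : ∀ i, B i - E i ∈ vanishingIdeal (belowDegree (Fin 2) n)) (i : Fin 2) :
    A.comp B i - A.comp E i ∈ vanishingIdeal (belowDegree (Fin 2) n) :=
  subst_sub_subst_mem _ hB hE h (A i)

theorem FormalMap.sub_comp_mem {n : ℕ} {A B E : FormalMap}
    (hE : ∀ i, constantCoeff (E i) = 0)
    (h : ∀ i, A i - B i ∈ vanishingIdeal (belowDegree (Fin 2) n)) (i : Fin 2) :
    A.comp E i - B.comp E i ∈ vanishingIdeal (belowDegree (Fin 2) n) := by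
  have := subst_mem_belowDegree hE n _ (h i)
  have hs := hasSubst_of_zero hE
  rwa [← coe_substAlgHom hs, map_sub, coe_substAlgHom] at this

theorem exists_coeff_graphSeries_ne_zero {p : ℕ} {c : ℂ} {g h : Series₃}
    (hn : IsNormalForm p c g h) : ∃ i, coeff (Finsupp.single i 1) (graphSeries h) ≠ 0 := by
  refine ⟨Sum.inl 1, ?_⟩
  rw [graphSeries, hn.subst_eq (constantCoeff_X_eq _) (constantCoeff_X_eq _)
    (constantCoeff_half_smul (constantCoeff_X_eq _) (constantCoeff_X_eq _)), smul_eq_C_mul,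
    smul_eq_C_mul]
  simp [coeff_single_eq, Derivation.leibniz, pow_two]

/-- Conjugating by the admissible coordinates φ preserves agreement with the identity up to degree
m, and φ ∘ K ∘ φ⁻¹ = id forces K = id. -/
theorem eq_X_of_mapsInto_self_of_isNonResonant {m : ℕ} (hm : 1 ≤ m) {M : RealHypersurfaceGerm}
    (hM : M.IsNonResonantOfInfiniteType m) {K : FormalMap} (hK0 : ∀ i, constantCoeff (K i) = 0)
    (hK : K.MapsInto M.defSeries M.defSeries)
    (hj : ∀ i, K i - X i ∈ vanishingIdeal (belowDegree (Fin 2) (m + 1))) :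
    K = fun i => X i := by
  obtain ⟨p, rfl⟩ : ∃ p, m = p + 1 := ⟨m - 1, by omega⟩
  obtain ⟨φ, h, Φ, ⟨-, hφ, hadm, hφM⟩, hass, hres⟩ := hM
  obtain ⟨c, g, hc0, hn⟩ := hadm.exists_normalForm
  obtain ⟨ψ, hψ0, hφψ, hψφ⟩ := hφ.exists_inverse
  have hX2 := constantCoeff_X_eq (σ := Fin 2)
  have hψM : ψ.MapsInto (graphSeries h) M.defSeries :=
    hφM.inverse hφ.1 hψ0 hφψ M.vanishes (exists_coeff_graphSeries_ne_zero hn)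
  have hφK0 := FormalMap.constantCoeff_comp hφ.1 hK0
  have hA := (hφM.comp hφ.1 hK0 hK).comp hφK0 hψ0 hψM
  have hA0 := FormalMap.constantCoeff_comp hφK0 hψ0
  have h1 := FormalMap.comp_sub_comp_mem φ hK0 hX2 hj
  rw [FormalMap.comp_X] at h1
  have h2 := FormalMap.sub_comp_mem hψ0 h1
  rw [hφψ] at h2
  have h3 : (φ.comp K).comp ψ = fun i => X i :=
    funext (eq_X_of_mapsInto_self hc0 hn hass hres hA0 hA h2)
  have h4 : φ.comp K = φ := by
    have := congrArg (fun E : FormalMap => E.comp φ) h3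
    rwa [FormalMap.comp_assoc _ hψ0 hφ.1, hψφ, FormalMap.comp_X, FormalMap.X_comp hφ.1] at this
  have h5 := congrArg ψ.comp h4
  rwa [← FormalMap.comp_assoc _ hφ.1 hK0, hψφ, FormalMap.X_comp hK0] at h5

end Reduction

end InfiniteType

end

/-! ### Unique determination by the `m`-jet. -/

theorem mainTheorem8 (m : ℕ) (hm : 1 ≤ m) (M M' : InfiniteType.RealHypersurfaceGerm)
    (hM : M.IsNonResonantOfInfiniteType m) (hM' : M'.IsNonResonantOfInfiniteType m)
    (H₁ H₂ : InfiniteType.FormalMap)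
    (h₁ : InfiniteType.IsFormalBiholomorphism M M' H₁)
    (h₂ : InfiniteType.IsFormalBiholomorphism M M' H₂)
    (hjet : ∀ (i : Fin 2) (n : Fin 2 →₀ ℕ), n.degree ≤ m →
      MvPowerSeries.coeff n (H₁ i) = MvPowerSeries.coeff n (H₂ i)) :
    H₁ = H₂ := by
  obtain ⟨B, hB0, hAB, hBA⟩ := h₂.1.exists_inverse
  have hR' : ∃ i, MvPowerSeries.coeff (Finsupp.single i 1) M'.defSeries ≠ 0 :=
    M'.smooth.imp' Sum.inl fun _ hi => hi
  have hB := h₂.2.inverse h₂.1.1 hB0 hAB M.vanishes hR'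
  have hK := hB.comp hB0 h₁.1.1 h₁.2
  -- With B = H₂⁻¹, the self-map B ∘ H₁ agrees with B ∘ H₂ = id in all degrees below m + 1.
  have hj := InfiniteType.FormalMap.comp_sub_comp_mem (n := m + 1) B h₁.1.1 h₂.1.1
    fun i e he => by
      rw [map_sub, hjet i e (Nat.lt_succ_iff.1 he), sub_self]
  rw [hBA] at hj
  have h := InfiniteType.eq_X_of_mapsInto_self_of_isNonResonant hm hM
    (InfiniteType.FormalMap.constantCoeff_comp hB0 h₁.1.1) hK hj
  have h' := congrArg H₂.comp h
  rwa [← InfiniteType.FormalMap.comp_assoc _ hB0 h₁.1.1, hAB,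
    InfiniteType.FormalMap.X_comp h₁.1.1, InfiniteType.FormalMap.comp_X] at h'
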